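/- Let $f:\mathbb{R}^d\to\mathbb{R}$ be convex and continuously differentiable, let $A_1,\dots,A_d\in\mathbb{R}^{m\times n}$, put $\mathcal{A}X=(\langle A_1,X\rangle,\dots,\langle A_d,X\rangle)$ and $\mathcal{A}^*z=\sum_i z_iA_i$ (Frobenius inner product), and let $\alpha\ge 0$. Let $S_\star$ be the set of minimizers of $f(\mathcal{A}X)$ over all $X\in\mathbb{R}^{m\times n}$ with $\|X\|_{S_1}\le\alpha$, where $\|X\|_{S_1}$ is the sum of the singular values of $X$. Let $r$ be a nonnegative integer and suppose that every matrix in $S_\star$ has rank at most $r$. Run SketchyCGM with rank parameter $r$, without a stopping rule. That is, draw independent standard normal matrices $\Omega\in\mathbb{R}^{n\times(2r+1)}$ and $\Psi\in\mathbb{R}^{(4r+3)\times m}$, set $z_0=0\in\mathbb{R}^d$, $Y_0=0\in\mathbb{R}^{m\times(2r+1)}$ and $W_0=0\in\mathbb{R}^{(4r+3)\times n}$, and for $t=0,1,2,\dots$ let $(u_t,v_t)$ be a (nonrandom) pair of unit left and right singular vectors of $\mathcal{A}^*(\nabla f(z_t))$ for its largest singular value, chosen arbitrarily if there are several, let $H_t=-\alpha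 u_tv_t^{*}$ and $\eta_t=2/(t+2)$, and update $$z_{t+1}=(1-\eta_t)z_t+\eta_t\mathcal{A}H_t,\qquad Y_{t+1}=(1-\eta_t)Y_t+\eta_tH_t\Omega,\qquad W_{t+1}=(1-\eta_t)W_t+\eta_t\Psi H_t .$$ For each $t$ let $\hat X_t$ be the reconstruction $\hat X_t=Q_t[(\Psi Q_t)^\dagger W_t]_r$, where $Q_t$ has orthonormal columns that span the range of $Y_t$, ${}^\dagger$ is the Moore–Penrose pseudoinverse and $[M]_r$ is a best approximation of $M$ in Frobenius norm by a matrix of rank at most $r$; the choices of $Q_t$ and of $[\,\cdot\,]_r$ are arbitrary, as long as $\hat X_t$ is a random variable. Then $S_\star$ is nonempty, $\operatorname{dist}_{\mathrm F}(\hat X_t,S_\star)$ (the Frobenius-norm distance from $\hat X_t$ to $S_\star$) has finite expectation for every $t$, and $$\mathbb{E}\operatorname{dist}_{\mathrm F}(\hat X_t,S_\star)\to 0\qquad\text{as } t\to\infty .$$ -/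

import Mathlib

noncomputable section

namespace SketchyCGM

open MeasureTheory ProbabilityTheory Matrix

attribute [local instance] Matrix.frobeniusNormedAddCommGroup

/-- The Schatten 1-norm: the sum of the singular values of a real `m × n` matrix (the singular
values with index at least `n` vanish). -/
def schattenOneNorm {m n : ℕ} (X : Matrix (Fin m) (Fin n) ℝ) : ℝ :=
  ∑ i ∈ Finset.range n, (Matrix.toLpLin 2 2 X).singularValues i

/-- The measurement map `X ↦ (⟨A₁, X⟩, …, ⟨A_d, X⟩)` (Frobenius inner products). -/
def measure {m n d : ℕ} (A : Fin d → Matrix (Fin m) (Fin n) ℝ)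
    (X : Matrix (Fin m) (Fin n) ℝ) : EuclideanSpace ℝ (Fin d) :=
  WithLp.toLp 2 fun i => ∑ a, ∑ b, A i a b * X a b

/-- The adjoint `z ↦ ∑ᵢ zᵢ Aᵢ` of the measurement map. -/
def measureAdjoint {m n d : ℕ} (A : Fin d → Matrix (Fin m) (Fin n) ℝ)
    (z : EuclideanSpace ℝ (Fin d)) : Matrix (Fin m) (Fin n) ℝ :=
  ∑ i, z i • A i

/-- The solutions of: minimize `f (𝒜 X)` subject to `‖X‖_{S₁} ≤ α`. -/
def solutionSet {m n d : ℕ} (f : EuclideanSpace ℝ (Fin d) → ℝ)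
    (A : Fin d → Matrix (Fin m) (Fin n) ℝ) (α : ℝ) : Set (Matrix (Fin m) (Fin n) ℝ) :=
  {X | schattenOneNorm X ≤ α ∧
    ∀ X' : Matrix (Fin m) (Fin n) ℝ, schattenOneNorm X' ≤ α →
      f (measure A X) ≤ f (measure A X')}

/-- The Frobenius-norm distance from a matrix to a set of matrices. -/
def distF {m n : ℕ} (M : Matrix (Fin m) (Fin n) ℝ) (S : Set (Matrix (Fin m) (Fin n) ℝ)) : ℝ :=
  Metric.infDist M S

/-- `(u, v)` is a left/right pair of maximum singular vectors of `M`. -/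
def IsMaxSingVec {m n : ℕ} (M : Matrix (Fin m) (Fin n) ℝ)
    (u : EuclideanSpace ℝ (Fin m)) (v : EuclideanSpace ℝ (Fin n)) : Prop :=
  ‖u‖ = 1 ∧ ‖v‖ = 1 ∧
    Matrix.toLpLin 2 2 M v = (Matrix.toLpLin 2 2 M).singularValues 0 • u ∧
    Matrix.toLpLin 2 2 Mᵀ u = (Matrix.toLpLin 2 2 M).singularValues 0 • v

/-- The learning rate `2 / (t + 2)`. -/
def stepSize (t : ℕ) : ℝ := 2 / ((t : ℝ) + 2)

/-- The rank-one update matrix `-α u vᵀ`. -/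
def direction {m n : ℕ} (α : ℝ) (u : EuclideanSpace ℝ (Fin m)) (v : EuclideanSpace ℝ (Fin n)) :
    Matrix (Fin m) (Fin n) ℝ :=
  -(α • Matrix.vecMulVec u.ofLp v.ofLp)

/-- The iterates `z_t` of the algorithm that uses the singular vectors `(u t, v t)` at step `t`. -/
def zIter {m n d : ℕ} (A : Fin d → Matrix (Fin m) (Fin n) ℝ) (α : ℝ)
    (u : ℕ → EuclideanSpace ℝ (Fin m)) (v : ℕ → EuclideanSpace ℝ (Fin n)) :
    ℕ → EuclideanSpace ℝ (Fin d)
  | 0 => 0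
  | t + 1 => (1 - stepSize t) • zIter A α u v t +
      stepSize t • measure A (direction α (u t) (v t))

/-- The range sketches `Y_t`, for the test matrix `Om`. -/
def rangeSketch {m n k : ℕ} (α : ℝ)
    (u : ℕ → EuclideanSpace ℝ (Fin m)) (v : ℕ → EuclideanSpace ℝ (Fin n))
    (Om : Matrix (Fin n) (Fin k) ℝ) : ℕ → Matrix (Fin m) (Fin k) ℝ
  | 0 => 0
  | t + 1 => (1 - stepSize t) • rangeSketch α u v Om t +
      stepSize t • (direction α (u t) (v t) * Om)

/-- The co-range sketches `W_t`, for the test matrix `Ps`. -/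
def corangeSketch {m n l : ℕ} (α : ℝ)
    (u : ℕ → EuclideanSpace ℝ (Fin m)) (v : ℕ → EuclideanSpace ℝ (Fin n))
    (Ps : Matrix (Fin l) (Fin m) ℝ) : ℕ → Matrix (Fin l) (Fin n) ℝ
  | 0 => 0
  | t + 1 => (1 - stepSize t) • corangeSketch α u v Ps t +
      stepSize t • (Ps * direction α (u t) (v t))

/-- `G` is the (Moore–Penrose) pseudoinverse of the real matrix `M`. -/
def IsPseudoinverse {p q : ℕ} (M : Matrix (Fin p) (Fin q) ℝ) (G : Matrix (Fin q) (Fin p) ℝ) :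
    Prop :=
  M * G * M = M ∧ G * M * G = G ∧ (M * G)ᵀ = M * G ∧ (G * M)ᵀ = G * M

/-- `N` is a best rank-`r` approximation of `M` in the Frobenius norm. -/
def IsBestRankApprox {p q : ℕ} (r : ℕ) (M N : Matrix (Fin p) (Fin q) ℝ) : Prop :=
  N.rank ≤ r ∧ ∀ N' : Matrix (Fin p) (Fin q) ℝ, N'.rank ≤ r → ‖M - N‖ ≤ ‖M - N'‖

/-- The columns of `Q` form an orthonormal basis of the range of `Y`. -/
def IsOrth {m k q : ℕ} (Y : Matrix (Fin m) (Fin k) ℝ) (Q : Matrix (Fin m) (Fin q) ℝ) : Prop :=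
  Qᵀ * Q = 1 ∧ LinearMap.range Q.mulVecLin = LinearMap.range Y.mulVecLin

/-- `Xhat` is an output of the rank-`r` reconstruction from the sketch `(Y, W)`:
`Q = orth Y`, `B = (Ψ Q)† W` and `Xhat = Q [B]_r`. -/
def IsReconstruction {m n k l : ℕ} (r : ℕ) (Ps : Matrix (Fin l) (Fin m) ℝ)
    (Y : Matrix (Fin m) (Fin k) ℝ) (W : Matrix (Fin l) (Fin n) ℝ)
    (Xhat : Matrix (Fin m) (Fin n) ℝ) : Prop :=
  ∃ (q : ℕ) (Q : Matrix (Fin m) (Fin q) ℝ) (G : Matrix (Fin q) (Fin l) ℝ)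
    (Br : Matrix (Fin q) (Fin n) ℝ),
    IsOrth Y Q ∧ IsPseudoinverse (Ps * Q) G ∧ IsBestRankApprox r (G * W) Br ∧ Xhat = Q * Br

/-- The random matrices `Om` and `Ps` are independent standard normal matrices: all their
entries together are independent standard normal random variables. -/
def IsStandardNormalPair {S : Type*} [MeasurableSpace S] (P : Measure S) {n k l m : ℕ}
    (Om : S → Matrix (Fin n) (Fin k) ℝ) (Ps : S → Matrix (Fin l) (Fin m) ℝ) : Prop :=
  (∀ i j, HasLaw (fun s => Om s i j) (gaussianReal 0 1) P) ∧
  (∀ i j, HasLaw (fun s => Ps s i j) (gaussianReal 0 1) P) ∧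
  iIndepFun (fun (e : (Fin n × Fin k) ⊕ (Fin l × Fin m)) (s : S) =>
    Sum.elim (fun p => Om s p.1 p.2) (fun p => Ps s p.1 p.2) e) P

end SketchyCGM

end

/-!
The sketches are linear, so the algorithm carries the images `z t = 𝒜 (X t)`, `Y t = X t * Om`,
`W t = Ps * X t` of matrix iterates `X t` (`xIter`) that are produced by the plain conditional
gradient method and do not depend on the test matrices. The proof has three parts.

*The iterates approach the solution set.* The Schatten 1-norm is dual to the spectral norm, so its
balls are compact and convex, and the rank-one direction of a top singular pair minimizes the
linearized objective over the ball (`frobInner_direction_le`). The gradient of `f` is uniformly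
continuous on the compact feasible set, which suffices for `f (z t)` to converge to the minimum
(`tendsto_conditionalGradient`). By compactness every subsequence of `X t` has a further subsequence
that converges to a solution `N` (`exists_subseq_tendsto_xIter`), whose rank is at most `r`.

*The reconstruction is quasi-optimal.* For fixed test matrices, the distance of the reconstruction
to `N` is at most a constant times `‖X t - N‖ + ρ t * (1 + κ * ‖Ps‖)`
(`norm_reconstruction_sub_le`), where `ρ t`, the `rangeError`, measures how well the columns of
`X t * Om` span those of `X t`, and `κ` is the norm of the inverse of `Ps` on the range of
`X t * Om`; `κ ^ 2` is `invStretch`. The proof compares with `N` directly and uses that the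
truncation is optimal among matrices of rank at most `r` with columns in the range of `X t * Om`.

*Gaussian estimates.* The range of `X t * Om` has dimension at most `2 * r + 1`, and `Ps` has
`4 * r + 3` rows. In an orthonormal basis of the range, `κ ^ 2` is at most the sum over the columns
of the inverse squared distance of a column of `Ps * Q` to the span of the others. The columns are
independent standard Gaussian vectors, and such a distance dominates three independent normal
variables, hence also the geometric mean of their absolute values; thus `𝔼 κ ^ 2` is bounded by
`4 * r + 3` times the cube of the finite moment `𝔼 |g| ^ (-2/3)`, for every range (`lintegral_invStretch_le`). The
same estimate shows that `N * Om` almost surely has the same range as `N`, so `ρ t → 0` almost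
surely along the subsequence; as `ρ t` is at most `α`, its expectation vanishes in the limit by
dominated convergence (`tendsto_lintegral_rangeError`). Independence of `Om` and `Ps` and Tonelli's
theorem combine the two bounds (`lintegral_reconstruction_error_le`).
-/

noncomputable section

namespace SketchyCGM

open MeasureTheory ProbabilityTheory Matrix Filter Topology
open scoped ENNReal NNReal RealInnerProductSpace

attribute [local instance] Matrix.frobeniusNormedAddCommGroup Matrix.frobeniusNormedSpace

/-! ### The Frobenius inner product and the Schatten 1-norm -/

/-- The Frobenius inner product `⟨M, X⟩ = ∑ M a b * X a b`. -/
def frobInner {m n : ℕ} (M X : Matrix (Fin m) (Fin n) ℝ) : ℝ := ∑ a, ∑ b, M a b * X a b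

section frob

variable {m n : ℕ}

lemma frobInner_add_right (M X Y : Matrix (Fin m) (Fin n) ℝ) :
    frobInner M (X + Y) = frobInner M X + frobInner M Y := by
  simp [frobInner, mul_add, Finset.sum_add_distrib]

lemma frobInner_smul_right (M X : Matrix (Fin m) (Fin n) ℝ) (c : ℝ) :
    frobInner M (c • X) = c * frobInner M X := by
  simp [frobInner, Finset.mul_sum, mul_left_comm]

lemma norm_sq_eq_sum (X : Matrix (Fin m) (Fin n) ℝ) : ‖X‖ ^ 2 = ∑ a, ∑ b, X a b ^ 2 := by
  have h0 : 0 ≤ ∑ a, ∑ b, ‖X a b‖ ^ (2 : ℝ) := by positivity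
  rw [frobenius_norm_def, ← Real.sqrt_eq_rpow, Real.sq_sqrt h0]
  simp

lemma frobInner_self (X : Matrix (Fin m) (Fin n) ℝ) : frobInner X X = ‖X‖ ^ 2 := by
  rw [norm_sq_eq_sum]; simp [frobInner, sq]

lemma continuous_frobInner (M : Matrix (Fin m) (Fin n) ℝ) : Continuous (frobInner M) := by
  unfold frobInner; fun_prop

lemma norm_sq_eq_sum_cols (X : Matrix (Fin m) (Fin n) ℝ) :
    ‖X‖ ^ 2 = ∑ b, ‖WithLp.toLp 2 (fun a => X a b)‖ ^ 2 := by
  rw [norm_sq_eq_sum, Finset.sum_comm]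
  simp [EuclideanSpace.real_norm_sq_eq]

lemma norm_mulVec_le (X : Matrix (Fin m) (Fin n) ℝ) (x : Fin n → ℝ) :
    ‖WithLp.toLp 2 (X *ᵥ x)‖ ≤ ‖X‖ * ‖WithLp.toLp 2 x‖ := by
  have e : ∀ {k : ℕ} (y : Fin k → ℝ), ‖replicateCol (Fin 1) y‖ = ‖WithLp.toLp 2 y‖ :=
    fun y => frobenius_norm_replicateCol y
  have h := frobenius_norm_mul X (replicateCol (Fin 1) x)
  rwa [← replicateCol_mulVec, e, e] at h

/-- The Frobenius inner product can be computed in any orthonormal basis of the domain. -/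
lemma frobInner_eq_sum_inner (M X : Matrix (Fin m) (Fin n) ℝ) {ι : Type*} [Fintype ι]
    (b : OrthonormalBasis ι ℝ (EuclideanSpace ℝ (Fin n))) :
    frobInner M X = ∑ i, ⟪toLpLin 2 2 M (b i), toLpLin 2 2 X (b i)⟫ := by
  classical
  have h1 := LinearMap.trace_eq_sum_inner
    (LinearMap.adjoint (toLpLin 2 2 M) ∘ₗ toLpLin 2 2 X) b
  have h2 := LinearMap.trace_eq_sum_inner
    (LinearMap.adjoint (toLpLin 2 2 M) ∘ₗ toLpLin 2 2 X) (EuclideanSpace.basisFun (Fin n) ℝ)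
  simp only [LinearMap.comp_apply, LinearMap.adjoint_inner_right] at h1 h2
  rw [← h1, h2, frobInner, Finset.sum_comm]
  refine Finset.sum_congr rfl fun i _ => ?_
  simp [toLpLin_apply, PiLp.inner_apply, mul_comm]

/-- The right singular vectors of `X`: an orthonormal basis in which the columns `X (b i)` are
orthogonal, of lengths the singular values. -/
lemma exists_right_singular_basis (X : Matrix (Fin m) (Fin n) ℝ) :
    ∃ b : OrthonormalBasis (Fin n) ℝ (EuclideanSpace ℝ (Fin n)),
      ∀ i j, ⟪toLpLin 2 2 X (b i), toLpLin 2 2 X (b j)⟫ =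
        if i = j then (toLpLin 2 2 X).singularValues i ^ 2 else 0 := by
  set T := toLpLin 2 2 X
  have hn : Module.finrank ℝ (EuclideanSpace ℝ (Fin n)) = n := by simp
  refine ⟨T.isSymmetric_adjoint_comp_self.eigenvectorBasis hn, fun i j => ?_⟩
  rw [← LinearMap.adjoint_inner_right, ← LinearMap.comp_apply,
    T.isSymmetric_adjoint_comp_self.apply_eigenvectorBasis hn, inner_smul_right,
    OrthonormalBasis.inner_eq_ite, T.sq_singularValues_fin hn]
  by_cases h : i = j <;> simp [h]

lemma norm_apply_le_singularValues_zero (X : Matrix (Fin m) (Fin n) ℝ)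
    (x : EuclideanSpace ℝ (Fin n)) :
    ‖toLpLin 2 2 X x‖ ≤ (toLpLin 2 2 X).singularValues 0 * ‖x‖ := by
  obtain ⟨b, hb⟩ := exists_right_singular_basis X
  refine abs_le_of_sq_le_sq' ?_
    (mul_nonneg (LinearMap.singularValues_nonneg _ _) (norm_nonneg _)) |>.2
  have hx : toLpLin 2 2 X x = ∑ i, ⟪b i, x⟫ • toLpLin 2 2 X (b i) := by
    conv_lhs => rw [← b.sum_repr' x]
    simp
  rw [← real_inner_self_eq_norm_sq, hx, sum_inner, mul_pow, ← b.sum_sq_norm_inner_right x,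
    Finset.mul_sum]
  refine Finset.sum_le_sum fun i _ => ?_
  have hle := LinearMap.singularValues_antitone (toLpLin 2 2 X) (Nat.zero_le (i : ℕ))
  have h0 := LinearMap.singularValues_nonneg (toLpLin 2 2 X) (i : ℕ)
  simp only [inner_sum, inner_smul_left, inner_smul_right, hb]
  simp only [mul_ite, mul_zero, Finset.sum_ite_eq, Finset.mem_univ, if_true, Real.norm_eq_abs,
    sq_abs, conj_trivial]
  nlinarith [pow_le_pow_left₀ h0 hle 2, sq_nonneg ⟪b i, x⟫]

/-- Half of the duality between the spectral norm and the Schatten 1-norm. -/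
lemma frobInner_le_schattenOneNorm (M X : Matrix (Fin m) (Fin n) ℝ) {s : ℝ}
    (hM : ∀ x, ‖toLpLin 2 2 M x‖ ≤ s * ‖x‖) :
    frobInner M X ≤ s * schattenOneNorm X := by
  obtain ⟨b, hb⟩ := exists_right_singular_basis X
  rw [frobInner_eq_sum_inner M X b, schattenOneNorm, ← Fin.sum_univ_eq_sum_range
    (fun i => (toLpLin 2 2 X).singularValues i), Finset.mul_sum]
  refine Finset.sum_le_sum fun i _ => ?_
  have h1 : ‖toLpLin 2 2 X (b i)‖ = (toLpLin 2 2 X).singularValues i := by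
    rw [← sq_eq_sq₀ (norm_nonneg _) (LinearMap.singularValues_nonneg _ _),
      ← real_inner_self_eq_norm_sq, hb]
    simp
  have h2 := hM (b i)
  rw [b.norm_eq_one, mul_one] at h2
  refine (real_inner_le_norm _ _).trans ?_
  rw [h1]
  exact mul_le_mul_of_nonneg_right h2 (LinearMap.singularValues_nonneg _ _)

/-- The other half of the duality: the Schatten 1-norm of `X` is attained by pairing `X` with the
partial isometry of its polar decomposition, which sends the right singular vectors of `X` to its
left singular vectors. -/
lemma exists_frobInner_eq_schattenOneNorm (X : Matrix (Fin m) (Fin n) ℝ) :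
    ∃ M : Matrix (Fin m) (Fin n) ℝ, (∀ x, ‖toLpLin 2 2 M x‖ ≤ ‖x‖) ∧
      frobInner M X = schattenOneNorm X := by
  obtain ⟨b, hb⟩ := exists_right_singular_basis X
  set σ := (toLpLin 2 2 X).singularValues
  set T : EuclideanSpace ℝ (Fin n) →ₗ[ℝ] EuclideanSpace ℝ (Fin m) :=
    b.toBasis.constr ℝ (fun i => (σ i)⁻¹ • toLpLin 2 2 X (b i))
  have hTb : ∀ i, T (b i) = (σ i)⁻¹ • toLpLin 2 2 X (b i) := fun i => by
    rw [← b.coe_toBasis]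
    exact b.toBasis.constr_basis ℝ _ i
  have hM : toLpLin 2 2 ((toLpLin 2 2).symm T) = T := LinearEquiv.apply_symm_apply _ _
  refine ⟨(toLpLin 2 2).symm T, fun x => ?_, ?_⟩
  · rw [hM]
    refine abs_le_of_sq_le_sq' ?_ (norm_nonneg _) |>.2
    have hx : T x = ∑ i, ⟪b i, x⟫ • T (b i) := by
      conv_lhs => rw [← b.sum_repr' x]
      simp
    rw [← real_inner_self_eq_norm_sq, hx, sum_inner, ← b.sum_sq_norm_inner_right x]
    refine Finset.sum_le_sum fun i _ => ?_
    simp only [inner_sum, inner_smul_left, inner_smul_right, hTb, hb]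
    simp only [mul_ite, mul_zero, Finset.sum_ite_eq, Finset.mem_univ, if_true, Real.norm_eq_abs,
      sq_abs, conj_trivial]
    by_cases h : σ i = 0
    · simp [h, sq_nonneg]
    · field_simp
      exact le_rfl
  · rw [frobInner_eq_sum_inner _ X b, schattenOneNorm, ← Fin.sum_univ_eq_sum_range
      (fun i => (toLpLin 2 2 X).singularValues i)]
    refine Finset.sum_congr rfl fun i _ => ?_
    rw [hM, hTb, inner_smul_left, hb]
    by_cases h : σ i = 0
    · simp [h, σ] at *
    · simp only [if_true, conj_trivial]
      change (σ i)⁻¹ * σ i ^ 2 = σ i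
      field_simp

lemma schattenOneNorm_le_iff (X : Matrix (Fin m) (Fin n) ℝ) (α : ℝ) :
    schattenOneNorm X ≤ α ↔
      ∀ M : Matrix (Fin m) (Fin n) ℝ, (∀ x, ‖toLpLin 2 2 M x‖ ≤ ‖x‖) → frobInner M X ≤ α := by
  constructor
  · intro h M hM
    have := frobInner_le_schattenOneNorm M X (s := 1) (by simpa using hM)
    linarith
  · intro h
    obtain ⟨M, hM, he⟩ := exists_frobInner_eq_schattenOneNorm X
    exact he ▸ h M hM

lemma schattenOneNorm_nonneg (X : Matrix (Fin m) (Fin n) ℝ) : 0 ≤ schattenOneNorm X :=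
  Finset.sum_nonneg fun _ _ => LinearMap.singularValues_nonneg _ _

lemma norm_le_schattenOneNorm (X : Matrix (Fin m) (Fin n) ℝ) : ‖X‖ ≤ schattenOneNorm X := by
  have h := frobInner_le_schattenOneNorm X X (s := ‖X‖) (fun x => by
    simpa [toLpLin_apply] using norm_mulVec_le X x.ofLp)
  rw [frobInner_self, sq] at h
  rcases (norm_nonneg X).eq_or_lt with h0 | h0
  · rw [← h0]; exact schattenOneNorm_nonneg X
  · exact le_of_mul_le_mul_left h h0

/-- The feasible set of the optimization problem. -/
def schattenBall (m n : ℕ) (α : ℝ) : Set (Matrix (Fin m) (Fin n) ℝ) := {X | schattenOneNorm X ≤ α}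

lemma schattenBall_eq_iInter (α : ℝ) : schattenBall m n α =
    ⋂ (M : Matrix (Fin m) (Fin n) ℝ) (_ : ∀ x, ‖toLpLin 2 2 M x‖ ≤ ‖x‖),
      {X | frobInner M X ≤ α} := by
  ext X; simp [schattenBall, schattenOneNorm_le_iff]

lemma isCompact_schattenBall (α : ℝ) : IsCompact (schattenBall m n α) := by
  have : ProperSpace (Matrix (Fin m) (Fin n) ℝ) := FiniteDimensional.proper ℝ _
  refine (isCompact_closedBall (0 : Matrix (Fin m) (Fin n) ℝ) α).of_isClosed_subset ?_ ?_
  · rw [schattenBall_eq_iInter]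
    exact isClosed_iInter fun M => isClosed_iInter fun _ =>
      isClosed_le (continuous_frobInner M) continuous_const
  · intro X hX
    rw [mem_closedBall_zero_iff]
    exact (norm_le_schattenOneNorm X).trans hX

lemma convex_schattenBall (α : ℝ) : Convex ℝ (schattenBall m n α) := by
  rw [schattenBall_eq_iInter]
  refine convex_iInter fun M => convex_iInter fun _ => ?_
  intro X hX Y hY a b ha hb hab
  simp only [Set.mem_ofPred_eq, frobInner_add_right, frobInner_smul_right] at *
  calc _ ≤ a * α + b * α := by gcongr
    _ = α := by rw [← add_mul, hab, one_mul]

lemma zero_mem_schattenBall {α : ℝ} (hα : 0 ≤ α) : 0 ∈ schattenBall m n α := by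
  simp [schattenBall, schattenOneNorm, hα]

lemma frobInner_direction (M : Matrix (Fin m) (Fin n) ℝ) (α : ℝ) (u : EuclideanSpace ℝ (Fin m))
    (v : EuclideanSpace ℝ (Fin n)) :
    frobInner M (direction α u v) = -(α * ⟪u, toLpLin 2 2 M v⟫) := by
  simp only [frobInner, direction, toLpLin_apply, PiLp.inner_apply, mulVec, dotProduct,
    Matrix.neg_apply, Matrix.smul_apply, vecMulVec_apply, smul_eq_mul, Finset.mul_sum,
    RCLike.inner_apply, conj_trivial, ← Finset.sum_neg_distrib, Finset.sum_mul]
  exact Finset.sum_congr rfl fun a _ => Finset.sum_congr rfl fun b _ => by ring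

lemma direction_mem_schattenBall {α : ℝ} (hα : 0 ≤ α) {u : EuclideanSpace ℝ (Fin m)}
    {v : EuclideanSpace ℝ (Fin n)} (hu : ‖u‖ = 1) (hv : ‖v‖ = 1) :
    direction α u v ∈ schattenBall m n α := by
  refine (schattenOneNorm_le_iff _ _).2 fun M hM => ?_
  rw [frobInner_direction, ← mul_neg, ← inner_neg_left]
  have h1 := real_inner_le_norm (-u) (toLpLin 2 2 M v)
  rw [norm_neg, hu, one_mul] at h1
  exact mul_le_of_le_one_right hα (h1.trans ((hM v).trans_eq hv))

/-- The rank-one direction built from a top singular pair of `D` minimizes the linear function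
`⟨D, ·⟩` over the Schatten ball. -/
lemma frobInner_direction_le {α : ℝ} {D X : Matrix (Fin m) (Fin n) ℝ}
    (hX : X ∈ schattenBall m n α) {u : EuclideanSpace ℝ (Fin m)} {v : EuclideanSpace ℝ (Fin n)}
    (h : IsMaxSingVec D u v) : frobInner D (direction α u v) ≤ frobInner D X := by
  obtain ⟨hu, hv, h1, -⟩ := h
  have hs := LinearMap.singularValues_nonneg (toLpLin 2 2 D) 0
  have h2 := frobInner_le_schattenOneNorm D (-X) (norm_apply_le_singularValues_zero D)
  have h3 : schattenOneNorm (-X) ≤ α := by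
    refine (schattenOneNorm_le_iff _ _).2 fun M hM => ?_
    have := (schattenOneNorm_le_iff _ _).1 hX (-M) (by simpa using hM)
    simpa [frobInner] using this
  rw [frobInner_direction, h1, inner_smul_right, real_inner_self_eq_norm_sq, hu]
  have h4 : frobInner D (-X) = -frobInner D X := by simp [frobInner]
  rw [h4] at h2
  nlinarith [mul_le_mul_of_nonneg_left h3 hs]

end frob

/-! ### Convergence of the conditional gradient method for continuously differentiable functions -/

/-- The recursion of the conditional gradient method, with vanishing rather than `O(η)` errors. -/
lemma tendsto_zero_of_stepSize_recursion {a ω : ℕ → ℝ} (ha : ∀ t, 0 ≤ a t) (hω0 : ∀ t, 0 ≤ ω t)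
    (hω : Tendsto ω atTop (𝓝 0))
    (h : ∀ t, a (t + 1) ≤ (1 - stepSize t) * a t + stepSize t * ω t) :
    Tendsto a atTop (𝓝 0) := by
  have key : ∀ t : ℕ, (t : ℝ) * (t + 1) * a t ≤ 2 * t * ∑ s ∈ Finset.range t, ω s := by
    intro t
    induction t with
    | zero => simp
    | succ t ih =>
      have h0 : 0 ≤ ∑ s ∈ Finset.range t, ω s := Finset.sum_nonneg fun s _ => hω0 s
      have h1 : ((t : ℝ) + 1) * (t + 2) * a (t + 1) ≤
          t * (t + 1) * a t + 2 * (t + 1) * ω t := by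
        calc ((t : ℝ) + 1) * (t + 2) * a (t + 1)
            ≤ (t + 1) * (t + 2) * ((1 - stepSize t) * a t + stepSize t * ω t) := by
              gcongr; exact h t
          _ = t * (t + 1) * a t + 2 * (t + 1) * ω t := by
              unfold stepSize; field_simp; ring
      rw [Finset.sum_range_succ]
      push_cast
      nlinarith
  have hces : Tendsto (fun t : ℕ => 2 * ((t : ℝ)⁻¹ * ∑ s ∈ Finset.range t, ω s)) atTop (𝓝 0) := by
    simpa using hω.cesaro.const_mul 2
  refine tendsto_of_tendsto_of_tendsto_of_le_of_le' tendsto_const_nhds hces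
    (Eventually.of_forall ha) ?_
  filter_upwards [eventually_ge_atTop 1] with t ht
  have ht' : (1 : ℝ) ≤ t := by exact_mod_cast ht
  have h0 : 0 ≤ ∑ s ∈ Finset.range t, ω s := Finset.sum_nonneg fun s _ => hω0 s
  have h2 : (t : ℝ) * a t ≤ 2 * ∑ s ∈ Finset.range t, ω s := by
    have h3 : (t : ℝ) * (t * a t) ≤ t * (2 * ∑ s ∈ Finset.range t, ω s) := by
      nlinarith [key t, mul_nonneg (by positivity : (0 : ℝ) ≤ t) (ha t)]
    exact le_of_mul_le_mul_left h3 (by linarith)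
  rw [← mul_assoc, mul_comm 2, mul_assoc, ← div_eq_inv_mul, le_div_iff₀ (by linarith), mul_comm]
  exact h2

section cgm

variable {E : Type*} [NormedAddCommGroup E] [InnerProductSpace ℝ E] [CompleteSpace E]

lemma add_inner_gradient_le {f : E → ℝ} (hf : ConvexOn ℝ Set.univ f)
    (hd : Differentiable ℝ f) (x y : E) : f x + ⟪gradient f x, y - x⟫ ≤ f y := by
  have hg : ConvexOn ℝ Set.univ (fun t : ℝ => f (AffineMap.lineMap x y t)) :=
    hf.comp_affineMap (AffineMap.lineMap x y)
  have hl : HasDerivAt (fun t : ℝ => AffineMap.lineMap x y t) (y - x) 0 :=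
    AffineMap.hasDerivAt_lineMap
  have hfd : HasFDerivAt f (fderiv ℝ f x) (AffineMap.lineMap x y (0 : ℝ)) := by
    simpa using (hd x).hasFDerivAt
  have hder : HasDerivAt (fun t : ℝ => f (AffineMap.lineMap x y t)) (⟪gradient f x, y - x⟫) 0 := by
    have := hfd.comp_hasDerivAt (0 : ℝ) hl
    have e : ⟪gradient f x, y - x⟫ = fderiv ℝ f x (y - x) := by
      simp [gradient]
    rw [e]; exact this
  have := hg.le_slope_of_hasDerivAt (Set.mem_univ 0) (Set.mem_univ 1) one_pos hder
  simp only [slope_def_field, AffineMap.lineMap_apply_zero, AffineMap.lineMap_apply_one, sub_zero,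
    div_one] at this
  linarith

lemma continuous_gradient {f : E → ℝ} (hf : ContDiff ℝ 1 f) : Continuous (gradient f) :=
  (InnerProductSpace.toDual ℝ E).symm.continuous.comp (hf.continuous_fderiv one_ne_zero)

/-- The conditional gradient method with step sizes `2 / (t + 2)` on a compact convex set
converges in value. The gradient only has to be uniformly continuous on the set, so the curvature
error is `o(1)` times the step size, which the recursion tolerates. -/
theorem tendsto_conditionalGradient {f : E → ℝ} (hf : ConvexOn ℝ Set.univ f)
    (hd : ContDiff ℝ 1 f) {C : Set E} (hC : IsCompact C) {z h : ℕ → E} (hz : ∀ t, z t ∈ C)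
    (hh : ∀ t, h t ∈ C)
    (hstep : ∀ t, z (t + 1) = (1 - stepSize t) • z t + stepSize t • h t)
    (hmin : ∀ t, ∀ y ∈ C, ⟪gradient f (z t), h t⟫ ≤ ⟪gradient f (z t), y⟫)
    {y : E} (hy : y ∈ C) (hymin : ∀ x ∈ C, f y ≤ f x) :
    Tendsto (fun t => f (z t)) atTop (𝓝 (f y)) := by
  have hdiff : Differentiable ℝ f := hd.differentiable one_ne_zero
  obtain ⟨R, hR0, hR⟩ := hC.isBounded.exists_pos_norm_le
  have hη0 : ∀ t, 0 ≤ stepSize t := fun t => by unfold stepSize; positivity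
  have hsub : ∀ t, z (t + 1) - z t = stepSize t • (h t - z t) := fun t => by
    rw [hstep]; module
  have hnorm : ∀ t, ‖h t - z t‖ ≤ 2 * R := fun t => by
    have := norm_sub_le (h t) (z t)
    linarith [hR _ (hh t), hR _ (hz t)]
  have hη : Tendsto stepSize atTop (𝓝 0) := by
    have h1 : Tendsto (fun t : ℕ => (t : ℝ) + 2) atTop atTop :=
      tendsto_atTop_add_const_right _ _ tendsto_natCast_atTop_atTop
    exact h1.const_div_atTop 2
  have hdist : Tendsto (fun t => dist (z (t + 1)) (z t)) atTop (𝓝 0) := by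
    refine squeeze_zero (fun _ => dist_nonneg) (fun t => ?_) (by simpa using hη.mul_const (2 * R))
    rw [dist_eq_norm, hsub, norm_smul, Real.norm_of_nonneg (hη0 t)]
    exact mul_le_mul_of_nonneg_left (hnorm t) (hη0 t)
  set ω : ℕ → ℝ := fun t => ‖gradient f (z (t + 1)) - gradient f (z t)‖ * (2 * R) with hωdef
  have hω : Tendsto ω atTop (𝓝 0) := by
    have huc := hC.uniformContinuousOn_of_continuous (continuous_gradient hd).continuousOn
    rw [Metric.uniformContinuousOn_iff] at huc
    have : Tendsto (fun t => ‖gradient f (z (t + 1)) - gradient f (z t)‖) atTop (𝓝 0) := by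
      rw [Metric.tendsto_atTop]
      intro ε hε
      obtain ⟨δ, hδ, hδ'⟩ := huc ε hε
      obtain ⟨N, hN⟩ := (Metric.tendsto_atTop.1 hdist) δ hδ
      refine ⟨N, fun t ht => ?_⟩
      have h1 := hN t ht
      rw [Real.dist_eq, sub_zero, abs_of_nonneg dist_nonneg] at h1
      have h2 := hδ' _ (hz (t + 1)) _ (hz t) h1
      rwa [Real.dist_eq, sub_zero, abs_of_nonneg (norm_nonneg _), ← dist_eq_norm]
    simpa using this.mul_const (2 * R)
  suffices hs : Tendsto (fun t => f (z t) - f y) atTop (𝓝 0) by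
    simpa using hs.add_const (f y)
  refine tendsto_zero_of_stepSize_recursion (fun t => sub_nonneg.2 (hymin _ (hz t)))
    (fun t => by positivity) hω fun t => ?_
  have h1 := add_inner_gradient_le hf hdiff (z (t + 1)) (z t)
  have h2 := add_inner_gradient_le hf hdiff (z t) y
  have h3 : ⟪gradient f (z (t + 1)), z t - z (t + 1)⟫ =
      -(stepSize t * ⟪gradient f (z t), h t - z t⟫) -
      stepSize t * ⟪gradient f (z (t + 1)) - gradient f (z t), h t - z t⟫ := by
    rw [← neg_sub (z (t + 1)), hsub, inner_neg_right, inner_smul_right, inner_sub_left]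
    ring
  have h4 : ⟪gradient f (z (t + 1)) - gradient f (z t), h t - z t⟫ ≤ ω t :=
    (real_inner_le_norm _ _).trans (mul_le_mul_of_nonneg_left (hnorm t) (norm_nonneg _))
  have h5 : ⟪gradient f (z t), h t - z t⟫ ≤ f y - f (z t) := by
    have := hmin t y hy
    rw [inner_sub_right] at h2 ⊢
    linarith
  nlinarith [mul_le_mul_of_nonneg_left h4 (hη0 t), mul_le_mul_of_nonneg_left h5 (hη0 t)]

end cgm

/-! ### The implicit matrix iterates -/

section iterates

variable {m n d : ℕ}

lemma measure_add (A : Fin d → Matrix (Fin m) (Fin n) ℝ) (X Y : Matrix (Fin m) (Fin n) ℝ) :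
    measure A (X + Y) = measure A X + measure A Y := by
  ext i; simp [measure, mul_add, Finset.sum_add_distrib]

lemma measure_smul (A : Fin d → Matrix (Fin m) (Fin n) ℝ) (c : ℝ)
    (X : Matrix (Fin m) (Fin n) ℝ) : measure A (c • X) = c • measure A X := by
  ext i; simp [measure, Finset.mul_sum, mul_left_comm]

lemma continuous_measure (A : Fin d → Matrix (Fin m) (Fin n) ℝ) : Continuous (measure A) :=
  (PiLp.continuous_toLp 2 _).comp (continuous_pi fun i => continuous_frobInner (A i))

lemma inner_measure (A : Fin d → Matrix (Fin m) (Fin n) ℝ) (g : EuclideanSpace ℝ (Fin d))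
    (X : Matrix (Fin m) (Fin n) ℝ) : ⟪g, measure A X⟫ = frobInner (measureAdjoint A g) X := by
  simp only [PiLp.inner_apply, measure, RCLike.inner_apply, conj_trivial, frobInner,
    measureAdjoint, Matrix.sum_apply, Matrix.smul_apply, smul_eq_mul, Finset.sum_mul]
  rw [Finset.sum_comm]
  conv_rhs => enter [2, x]; rw [Finset.sum_comm]
  rw [Finset.sum_comm]
  conv_rhs => rw [Finset.sum_comm]
  exact Finset.sum_congr rfl fun i _ => Finset.sum_congr rfl fun a _ =>
    Finset.sum_congr rfl fun b _ => by ring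

/-- The matrix iterates that the algorithm never forms, of which it stores only the images under
the measurement map and under the two sketches. -/
def xIter (α : ℝ) (u : ℕ → EuclideanSpace ℝ (Fin m)) (v : ℕ → EuclideanSpace ℝ (Fin n)) :
    ℕ → Matrix (Fin m) (Fin n) ℝ
  | 0 => 0
  | t + 1 => (1 - stepSize t) • xIter α u v t + stepSize t • direction α (u t) (v t)

variable {α : ℝ} {u : ℕ → EuclideanSpace ℝ (Fin m)} {v : ℕ → EuclideanSpace ℝ (Fin n)}

lemma zIter_eq (A : Fin d → Matrix (Fin m) (Fin n) ℝ) (t : ℕ) :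
    zIter A α u v t = measure A (xIter α u v t) := by
  induction t with
  | zero => ext i; simp [zIter, xIter, measure]
  | succ t ih => rw [zIter, xIter, ih, measure_add, measure_smul, measure_smul]

lemma rangeSketch_eq {k : ℕ} (Om : Matrix (Fin n) (Fin k) ℝ) (t : ℕ) :
    rangeSketch α u v Om t = xIter α u v t * Om := by
  induction t with
  | zero => simp [rangeSketch, xIter]
  | succ t ih => rw [rangeSketch, xIter, ih, Matrix.add_mul, Matrix.smul_mul, Matrix.smul_mul]

lemma corangeSketch_eq {l : ℕ} (Ps : Matrix (Fin l) (Fin m) ℝ) (t : ℕ) :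
    corangeSketch α u v Ps t = Ps * xIter α u v t := by
  induction t with
  | zero => simp [corangeSketch, xIter]
  | succ t ih => rw [corangeSketch, xIter, ih, Matrix.mul_add, Matrix.mul_smul, Matrix.mul_smul]

lemma xIter_mem (hα : 0 ≤ α) (hu : ∀ t, ‖u t‖ = 1) (hv : ∀ t, ‖v t‖ = 1) (t : ℕ) :
    xIter α u v t ∈ schattenBall m n α := by
  induction t with
  | zero => exact zero_mem_schattenBall hα
  | succ t ih =>
    have h1 : stepSize t ≤ 1 := by
      unfold stepSize; rw [div_le_one (by positivity)]; linarith [(t.cast_nonneg : (0 : ℝ) ≤ t)]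
    exact convex_schattenBall α ih (direction_mem_schattenBall hα (hu t) (hv t))
      (sub_nonneg.2 h1) (by unfold stepSize; positivity) (by ring)

lemma solutionSet_nonempty {f : EuclideanSpace ℝ (Fin d) → ℝ} (hf : Continuous f)
    (A : Fin d → Matrix (Fin m) (Fin n) ℝ) (hα : 0 ≤ α) : (solutionSet f A α).Nonempty := by
  obtain ⟨X, hX, hmin⟩ := (isCompact_schattenBall (m := m) (n := n) α).exists_isMinOn
    ⟨0, zero_mem_schattenBall hα⟩ (hf.comp (continuous_measure A)).continuousOn
  exact ⟨X, hX, fun X' hX' => hmin hX'⟩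

/-- Every subsequence of the matrix iterates has a further subsequence that converges to a
solution. -/
theorem exists_subseq_tendsto_xIter {f : EuclideanSpace ℝ (Fin d) → ℝ}
    (hf_convex : ConvexOn ℝ Set.univ f) (hf_smooth : ContDiff ℝ 1 f)
    (A : Fin d → Matrix (Fin m) (Fin n) ℝ) (hα : 0 ≤ α)
    (huv : ∀ t, IsMaxSingVec (measureAdjoint A (gradient f (zIter A α u v t))) (u t) (v t))
    {ns : ℕ → ℕ} (hns : Tendsto ns atTop atTop) :
    ∃ N ∈ solutionSet f A α, ∃ ms : ℕ → ℕ, StrictMono ms ∧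
      Tendsto (fun k => xIter α u v (ns (ms k))) atTop (𝓝 N) := by
  have hmem := xIter_mem hα (fun t => (huv t).1) (fun t => (huv t).2.1)
  have : FirstCountableTopology (Matrix (Fin m) (Fin n) ℝ) :=
    inferInstanceAs (FirstCountableTopology (Fin m → Fin n → ℝ))
  obtain ⟨N, hN, ms, hms, hlim⟩ :=
    (isCompact_schattenBall (m := m) (n := n) α).tendsto_subseq (fun k => hmem (ns k))
  obtain ⟨X₀, hX₀, hmin⟩ := solutionSet_nonempty hf_smooth.continuous A hα
  have hval : Tendsto (fun t => f (measure A (xIter α u v t))) atTop (𝓝 (f (measure A X₀))) := by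
    refine tendsto_conditionalGradient hf_convex hf_smooth
      ((isCompact_schattenBall α).image (continuous_measure A))
      (h := fun t => measure A (direction α (u t) (v t)))
      (fun t => ⟨_, hmem t, rfl⟩)
      (fun t => ⟨_, direction_mem_schattenBall hα (huv t).1 (huv t).2.1, rfl⟩)
      (fun t => ?_) ?_ ⟨X₀, hX₀, rfl⟩ ?_
    · rw [xIter, measure_add, measure_smul, measure_smul]
    · rintro t _ ⟨X, hX, rfl⟩
      rw [inner_measure, inner_measure, ← zIter_eq]
      exact frobInner_direction_le hX (huv t)
    · rintro _ ⟨X, hX, rfl⟩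
      exact hmin X hX
  have hlimval : Tendsto (fun k => f (measure A (xIter α u v (ns (ms k))))) atTop
      (𝓝 (f (measure A N))) :=
    ((hf_smooth.continuous.comp (continuous_measure A)).tendsto N).comp hlim
  have heq : f (measure A N) = f (measure A X₀) :=
    tendsto_nhds_unique hlimval (hval.comp (hns.comp hms.tendsto_atTop))
  exact ⟨N, ⟨hN, fun X' hX' => heq.trans_le (hmin X' hX')⟩, ms, hms, hlim⟩

end iterates

/-! ### Standard Gaussian vectors -/

/-- The law of a family of independent standard normal variables. -/
def gaussianPi (ι : Type*) [Fintype ι] : Measure (ι → ℝ) := Measure.pi fun _ => gaussianReal 0 1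

instance (ι : Type*) [Fintype ι] : IsProbabilityMeasure (gaussianPi ι) := by
  unfold gaussianPi; infer_instance

/-- Rotation invariance: the coefficients of a standard Gaussian vector along orthonormal vectors
are independent standard normal variables. -/
lemma measurePreserving_inner_orthonormal {ι κ : Type*} [Fintype ι] [Fintype κ]
    {w : κ → EuclideanSpace ℝ ι} (hw : Orthonormal ℝ w) :
    MeasurePreserving (fun (x : ι → ℝ) (k : κ) => ⟪w k, WithLp.toLp 2 x⟫)
      (gaussianPi ι) (gaussianPi κ) := by
  have hmeas : Measurable (fun (x : ι → ℝ) (k : κ) => ⟪w k, WithLp.toLp 2 x⟫) := by fun_prop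
  refine ⟨hmeas, ?_⟩
  have hT : Measurable (fun x : EuclideanSpace ℝ ι =>
      (WithLp.toLp 2 fun k => ⟪w k, x⟫ : EuclideanSpace ℝ κ)) := by fun_prop
  have h1 : (stdGaussian (EuclideanSpace ℝ ι)).map
      (fun x => (WithLp.toLp 2 fun k => ⟪w k, x⟫ : EuclideanSpace ℝ κ)) =
      stdGaussian (EuclideanSpace ℝ κ) := by
    have : IsProbabilityMeasure ((stdGaussian (EuclideanSpace ℝ ι)).map
      (fun x => (WithLp.toLp 2 fun k => ⟪w k, x⟫ : EuclideanSpace ℝ κ))) :=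
      Measure.isProbabilityMeasure_map hT.aemeasurable
    apply Measure.ext_of_charFun
    ext t
    have hin : ∀ x : EuclideanSpace ℝ ι,
        ⟪(WithLp.toLp 2 fun k => ⟪w k, x⟫ : EuclideanSpace ℝ κ), t⟫ =
          ⟪x, ∑ k, t k • w k⟫ := fun x => by
      rw [inner_sum, PiLp.inner_apply]
      refine Finset.sum_congr rfl fun k _ => ?_
      rw [inner_smul_right, real_inner_comm (w k) x]
      simp only [RCLike.inner_apply, conj_trivial]
    have hnorm : ‖∑ k, t k • w k‖ ^ 2 = ‖t‖ ^ 2 := by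
      rw [← real_inner_self_eq_norm_sq, hw.inner_sum, EuclideanSpace.real_norm_sq_eq]
      simp [sq]
    rw [charFun_apply, integral_map hT.aemeasurable (by fun_prop)]
    simp_rw [hin]
    rw [← charFun_apply, charFun_stdGaussian, charFun_stdGaussian]
    simp only [← Complex.ofReal_pow, hnorm]
  have h2 := congrArg (Measure.map (WithLp.ofLp : EuclideanSpace ℝ κ → κ → ℝ)) h1
  rw [← map_pi_eq_stdGaussian, ← map_pi_eq_stdGaussian, Measure.map_map (by fun_prop) hT,
    Measure.map_map (by fun_prop) (by fun_prop), Measure.map_map (by fun_prop) (by fun_prop)] at h2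
  have e : (WithLp.ofLp : EuclideanSpace ℝ κ → κ → ℝ) ∘ WithLp.toLp 2 = id := rfl
  rw [e, Measure.map_id] at h2
  exact h2

/-- The moment `𝔼 |g| ^ (-2/3)` of a standard normal variable. -/
def negMoment : ℝ≥0∞ := ∫⁻ x, (‖x‖ₑ ^ (2 / 3 : ℝ))⁻¹ ∂gaussianReal 0 1

lemma negMoment_lt_top : negMoment < ∞ := by
  have hpdf : gaussianPDF 0 1 ≤ fun _ => 1 := fun x => by
    rw [gaussianPDF, ENNReal.ofReal_le_one, gaussianPDFReal]
    refine mul_le_one₀ (inv_le_one_of_one_le₀ ?_) (Real.exp_nonneg _) (Real.exp_le_one_iff.2 ?_)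
    · rw [Real.one_le_sqrt]; simp; linarith [Real.pi_gt_three]
    · exact div_nonpos_of_nonpos_of_nonneg (neg_nonpos.2 (sq_nonneg _)) (by simp)
  have hle : gaussianReal 0 1 ≤ volume := by
    rw [gaussianReal_of_var_ne_zero _ one_ne_zero]
    refine (withDensity_mono (Eventually.of_forall hpdf)).trans_eq ?_
    exact withDensity_one
  rw [negMoment, ← lintegral_add_compl _ (measurableSet_ball (x := (0 : ℝ)) (ε := 1))]
  refine ENNReal.add_lt_top.2 ⟨?_, ?_⟩
  · have hint : IntegrableOn (fun x : ℝ => ‖x‖ ^ (-(2 / 3) : ℝ)) (Metric.ball 0 1) volume := by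
      refine integrableOn_ball_of_norm_le_rpow (C := 1) (α := 2 / 3) (by simp)
        (by simp; norm_num) (Eventually.of_forall fun x => ?_)
        (measurable_norm.pow_const _).aestronglyMeasurable
      rw [one_mul, Real.norm_of_nonneg (Real.rpow_nonneg (norm_nonneg _) _)]
    have hne : ∀ᵐ x : ℝ ∂(volume.restrict (Metric.ball 0 1)), x ≠ 0 := by
      refine ae_restrict_of_ae ?_
      simp [ae_iff]
    calc ∫⁻ x in Metric.ball (0 : ℝ) 1, (‖x‖ₑ ^ (2 / 3 : ℝ))⁻¹ ∂gaussianReal 0 1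
        ≤ ∫⁻ x in Metric.ball (0 : ℝ) 1, (‖x‖ₑ ^ (2 / 3 : ℝ))⁻¹ ∂volume :=
          lintegral_mono' (Measure.restrict_mono subset_rfl hle) le_rfl
      _ = ∫⁻ x in Metric.ball (0 : ℝ) 1, ‖‖x‖ ^ (-(2 / 3) : ℝ)‖ₑ ∂volume := by
          refine lintegral_congr_ae ?_
          filter_upwards [hne] with x hx
          have hx' : 0 < ‖x‖ := norm_pos_iff.2 hx
          rw [Real.enorm_eq_ofReal (r := ‖x‖ ^ _) (Real.rpow_nonneg (norm_nonneg _) _),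
            ← ENNReal.ofReal_rpow_of_pos hx', ofReal_norm, ENNReal.rpow_neg]
      _ < ∞ := hint.2
  · calc ∫⁻ x in (Metric.ball (0 : ℝ) 1)ᶜ, (‖x‖ₑ ^ (2 / 3 : ℝ))⁻¹ ∂gaussianReal 0 1
        ≤ ∫⁻ x in (Metric.ball (0 : ℝ) 1)ᶜ, 1 ∂gaussianReal 0 1 := by
          refine setLIntegral_mono (by fun_prop) fun x hx => ?_
          have h1 : 1 ≤ ‖x‖ := by simpa using hx
          rw [ENNReal.inv_le_one]
          refine ENNReal.one_le_rpow ?_ (by norm_num)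
          rw [← ofReal_norm]
          simpa using h1
      _ ≤ 1 := by rw [setLIntegral_one]; exact prob_le_one
      _ < ∞ := ENNReal.one_lt_top

lemma lintegral_prod_negMoment (κ : Type*) [Fintype κ] :
    ∫⁻ y : κ → ℝ, ∏ k, (‖y k‖ₑ ^ (2 / 3 : ℝ))⁻¹ ∂gaussianPi κ = negMoment ^ Fintype.card κ := by
  have hind : iIndepFun (fun (k : κ) (y : κ → ℝ) => (‖y k‖ₑ ^ (2 / 3 : ℝ))⁻¹) (gaussianPi κ) :=
    iIndepFun_pi (μ := fun _ : κ => gaussianReal 0 1) (X := fun _ x => (‖x‖ₑ ^ (2 / 3 : ℝ))⁻¹)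
      (fun _ => by fun_prop)
  rw [lintegral_prod_eq_prod_lintegral_of_indepFun _ _ hind (fun _ => by fun_prop)]
  have h : ∀ k : κ, ∫⁻ y, (‖y k‖ₑ ^ (2 / 3 : ℝ))⁻¹ ∂gaussianPi κ = negMoment := fun k =>
    (measurePreserving_eval (fun _ : κ => gaussianReal 0 1) k).lintegral_comp
      (f := fun x => (‖x‖ₑ ^ (2 / 3 : ℝ))⁻¹) (by fun_prop)
  simp [h]

/-- The distance from `g` to the span of the vectors `R j`, as an extended nonnegative real. -/
def spanDist {E σ : Type*} [NormedAddCommGroup E] [NormedSpace ℝ E] [Fintype σ] (g : E)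
    (R : σ → E) : ℝ≥0∞ := ⨅ c : σ → ℝ, ‖g - ∑ j, c j • R j‖ₑ

/-- A standard Gaussian vector stays away from a subspace of codimension at least three: its
distance to the subspace dominates three independent normal variables, so it has a finite moment of
order `-2`. -/
lemma lintegral_spanDist_le {l : ℕ} {σ : Type*} [Fintype σ] (hσ : Fintype.card σ + 3 ≤ l)
    (R : σ → EuclideanSpace ℝ (Fin l)) :
    ∫⁻ g, (spanDist (WithLp.toLp 2 g) R ^ 2)⁻¹ ∂gaussianPi (Fin l) ≤ negMoment ^ 3 := by
  set W := Submodule.span ℝ (Set.range R)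
  have hW : Module.finrank ℝ W ≤ Fintype.card σ := finrank_range_le_card R
  have hsum := W.finrank_add_finrank_orthogonal
  rw [finrank_euclideanSpace_fin] at hsum
  set b := stdOrthonormalBasis ℝ Wᗮ
  have h3 : 3 ≤ Module.finrank ℝ Wᗮ := by omega
  set w : Fin 3 → EuclideanSpace ℝ (Fin l) := fun k => b (Fin.castLE h3 k)
  have hw : Orthonormal ℝ w :=
    (b.orthonormal.comp_linearIsometry Wᗮ.subtypeₗᵢ).comp _ (Fin.castLE_injective h3)
  have hmp := measurePreserving_inner_orthonormal hw
  have hle : ∀ (g : Fin l → ℝ) (k : Fin 3),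
      ‖⟪w k, WithLp.toLp 2 g⟫‖ₑ ≤ spanDist (WithLp.toLp 2 g) R := fun g k => by
    refine le_iInf fun c => ?_
    have hmem : ∑ j, c j • R j ∈ W := Submodule.sum_mem _ fun j _ =>
      Submodule.smul_mem _ _ (Submodule.subset_span ⟨j, rfl⟩)
    have h0 : ⟪w k, ∑ j, c j • R j⟫ = 0 :=
      Submodule.inner_left_of_mem_orthogonal hmem (b (Fin.castLE h3 k)).2
    have h1 : ⟪w k, WithLp.toLp 2 g⟫ = ⟪w k, WithLp.toLp 2 g - ∑ j, c j • R j⟫ := by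
      rw [inner_sub_right, h0, sub_zero]
    have h2 := norm_inner_le_norm (𝕜 := ℝ) (w k) (WithLp.toLp 2 g - ∑ j, c j • R j)
    rw [hw.1 k, one_mul, ← h1] at h2
    exact enorm_le_iff_norm_le.2 h2
  calc ∫⁻ g, (spanDist (WithLp.toLp 2 g) R ^ 2)⁻¹ ∂gaussianPi (Fin l)
      ≤ ∫⁻ g, ∏ k : Fin 3, (‖⟪w k, WithLp.toLp 2 g⟫‖ₑ ^ (2 / 3 : ℝ))⁻¹ ∂gaussianPi (Fin l) := by
        refine lintegral_mono fun g => ?_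
        have hpow : (spanDist (WithLp.toLp 2 g) R ^ 2)⁻¹ =
            ∏ _k : Fin 3, (spanDist (WithLp.toLp 2 g) R ^ (2 / 3 : ℝ))⁻¹ := by
          rw [Finset.prod_const, Finset.card_univ, Fintype.card_fin, ← ENNReal.inv_pow,
            ← ENNReal.rpow_natCast, ← ENNReal.rpow_natCast, ← ENNReal.rpow_mul]
          norm_num
        dsimp only
        rw [hpow]
        refine Finset.prod_le_prod' fun k _ => ?_
        exact ENNReal.inv_le_inv.2 (ENNReal.rpow_le_rpow (hle g k) (by norm_num))
    _ = ∫⁻ y : Fin 3 → ℝ, ∏ k, (‖y k‖ₑ ^ (2 / 3 : ℝ))⁻¹ ∂gaussianPi (Fin 3) :=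
        hmp.lintegral_comp (f := fun y : Fin 3 → ℝ => ∏ k, (‖y k‖ₑ ^ (2 / 3 : ℝ))⁻¹) (by fun_prop)
    _ = negMoment ^ 3 := by rw [lintegral_prod_negMoment]; simp

/-! ### Gaussian matrices are well conditioned on low-dimensional subspaces -/

/-- The matrix with the given family of entries. -/
def toMatrix {a b : ℕ} (x : Fin a × Fin b → ℝ) : Matrix (Fin a) (Fin b) ℝ := of fun i j => x (i, j)

lemma continuous_toMatrix {a b : ℕ} :
    Continuous (toMatrix : (Fin a × Fin b → ℝ) → Matrix (Fin a) (Fin b) ℝ) := by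
  refine continuous_pi fun i => continuous_pi fun j => continuous_apply (i, j)

lemma measurable_spanDist {X E σ : Type*} [TopologicalSpace X] [MeasurableSpace X]
    [OpensMeasurableSpace X] [NormedAddCommGroup E] [NormedSpace ℝ E] [Fintype σ] {g : X → E}
    {R : X → σ → E} (hg : Continuous g) (hR : ∀ j, Continuous fun x => R x j) :
    Measurable fun x => spanDist (g x) (R x) :=
  UpperSemicontinuous.measurable <| upperSemicontinuous_iInf fun _ =>
    Continuous.upperSemicontinuous <| Continuous.enorm <|
      hg.sub <| continuous_finsetSum _ fun j _ => (hR j).const_smul _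

lemma measurePreserving_gaussianPi_sum (ι ι' : Type*) [Fintype ι] [Fintype ι'] :
    MeasurePreserving (MeasurableEquiv.sumPiEquivProdPi fun _ : ι ⊕ ι' => ℝ) (gaussianPi (ι ⊕ ι'))
      ((gaussianPi ι).prod (gaussianPi ι')) :=
  measurePreserving_sumPiEquivProdPi fun _ => gaussianReal 0 1

section columns

variable {l m : ℕ} {κ : Type*} {q : κ → EuclideanSpace ℝ (Fin m)}

/-- The unit vectors `e_a ⊗ q j` that read off the entries of `Ψ * q`. -/
def rowTensor (q : κ → EuclideanSpace ℝ (Fin m)) (p : Fin l × κ) :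
    EuclideanSpace ℝ (Fin l × Fin m) :=
  WithLp.toLp 2 fun x => if x.1 = p.1 then q p.2 x.2 else 0

lemma inner_rowTensor (p : Fin l × κ) (x : Fin l × Fin m → ℝ) :
    ⟪rowTensor q p, WithLp.toLp 2 x⟫ = (toMatrix x *ᵥ (q p.2).ofLp) p.1 := by
  simp [rowTensor, PiLp.inner_apply, Fintype.sum_prod_type, toMatrix, mulVec, dotProduct]

lemma orthonormal_rowTensor [DecidableEq κ] (hq : Orthonormal ℝ q) :
    Orthonormal ℝ (rowTensor q : Fin l × κ → EuclideanSpace ℝ (Fin l × Fin m)) := by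
  rw [orthonormal_iff_ite]
  rintro ⟨a, j⟩ ⟨a', j'⟩
  have h := (orthonormal_iff_ite.1 hq) j j'
  rw [PiLp.inner_apply] at h
  have : ⟪rowTensor q (a, j), rowTensor q (a', j')⟫ =
      if a = a' then ∑ s, ⟪q j s, q j' s⟫ else 0 := by
    rw [PiLp.inner_apply, Fintype.sum_prod_type, Finset.sum_eq_single a]
    · by_cases h : a = a' <;> simp [rowTensor, h]
    · intro b _ hb
      simp [rowTensor, hb]
    · simp
  rw [this, h]
  by_cases h1 : a = a' <;> by_cases h2 : j = j' <;> simp [h1, h2]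

/-- The distance of the column `Ψ (q i)` to the span of the other columns `Ψ (q j)`. -/
def columnDist [Fintype κ] [DecidableEq κ] (q : κ → EuclideanSpace ℝ (Fin m)) (i : κ)
    (Ψ : Matrix (Fin l) (Fin m) ℝ) : ℝ≥0∞ :=
  spanDist (WithLp.toLp 2 (Ψ *ᵥ (q i).ofLp) : EuclideanSpace ℝ (Fin l))
    (fun j : {j // j ≠ i} => WithLp.toLp 2 (Ψ *ᵥ (q j).ofLp))

lemma measurable_columnDist [Fintype κ] [DecidableEq κ] (q : κ → EuclideanSpace ℝ (Fin m))
    (i : κ) : Measurable fun x : Fin l × Fin m → ℝ => columnDist q i (toMatrix x) := by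
  have hc : ∀ j, Continuous fun x : Fin l × Fin m → ℝ =>
      (WithLp.toLp 2 (toMatrix x *ᵥ (q j).ofLp) : EuclideanSpace ℝ (Fin l)) := fun j =>
    (PiLp.continuous_toLp 2 _).comp (continuous_toMatrix.matrix_mulVec continuous_const)
  exact measurable_spanDist (hc i) fun j => hc j

/-- For orthonormal `q`, the columns `Ψ (q j)` are independent standard Gaussian vectors, so each
of them stays away from the span of the others. -/
lemma lintegral_columnDist_le [Fintype κ] [DecidableEq κ] (hq : Orthonormal ℝ q)
    (hl : Fintype.card κ + 2 ≤ l) (i : κ) :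
    ∫⁻ x, (columnDist q i (toMatrix x : Matrix (Fin l) (Fin m) ℝ) ^ 2)⁻¹
      ∂gaussianPi (Fin l × Fin m) ≤ negMoment ^ 3 := by
  set e : Fin l ⊕ (Fin l × {j // j ≠ i}) → Fin l × κ :=
    Sum.elim (fun a => (a, i)) (fun p => (p.1, p.2)) with he
  have hinj : Function.Injective e := by
    rintro (a | ⟨a, j, hj⟩) (a' | ⟨a', j', hj'⟩) h <;> simp [he] at h ⊢
    · exact h
    · exact hj' h.2.symm
    · exact hj h.2
    · exact h
  have mp1 := measurePreserving_inner_orthonormal ((orthonormal_rowTensor (l := l) hq).comp e hinj)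
  have mp := (measurePreserving_gaussianPi_sum (Fin l) (Fin l × {j // j ≠ i})).comp mp1
  set J : (Fin l → ℝ) × (Fin l × {j // j ≠ i} → ℝ) → ℝ≥0∞ := fun p =>
    (spanDist (WithLp.toLp 2 p.1 : EuclideanSpace ℝ (Fin l))
        (fun j => WithLp.toLp 2 fun a => p.2 (a, j)) ^ 2)⁻¹ with hJ
  have hJm : Measurable J :=
    ((measurable_spanDist (by fun_prop) fun j => by fun_prop).pow_const 2).inv
  calc _ = ∫⁻ p, J p ∂((gaussianPi (Fin l)).prod (gaussianPi (Fin l × {j // j ≠ i}))) := by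
        rw [← mp.lintegral_comp hJm]
        refine lintegral_congr fun x => ?_
        simp only [hJ, Function.comp_apply, inner_rowTensor]
        rfl
    _ = ∫⁻ R, ∫⁻ g, J (g, R) ∂gaussianPi (Fin l) ∂gaussianPi (Fin l × {j // j ≠ i}) :=
        lintegral_prod_symm' _ hJm
    _ ≤ ∫⁻ R, negMoment ^ 3 ∂gaussianPi (Fin l × {j // j ≠ i}) := by
        refine lintegral_mono fun R => lintegral_spanDist_le (σ := {j // j ≠ i}) ?_
          (fun j => WithLp.toLp 2 fun a => R (a, j))
        have h1 : 0 < Fintype.card κ := Fintype.card_pos_iff.2 ⟨i⟩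
        have h2 : Fintype.card {j // j ≠ i} = Fintype.card κ - 1 := by simp
        omega
    _ = negMoment ^ 3 := by simp

end columns

/-- The largest value of `‖y‖² / ‖Ψ y‖²` over the range of `Y`, taken over a countable dense set of
coefficient vectors so that measurability is clear. It is `∞` when `Ψ` is not injective on the
range of `Y`. -/
def invStretch {l m k : ℕ} (Ψ : Matrix (Fin l) (Fin m) ℝ) (Y : Matrix (Fin m) (Fin k) ℝ) : ℝ≥0∞ :=
  ⨆ j : ℕ, ‖(WithLp.toLp 2 (Y *ᵥ TopologicalSpace.denseSeq (Fin k → ℝ) j) :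
      EuclideanSpace ℝ (Fin m))‖ₑ ^ 2 /
    ‖(WithLp.toLp 2 (Ψ *ᵥ (Y *ᵥ TopologicalSpace.denseSeq (Fin k → ℝ) j)) :
      EuclideanSpace ℝ (Fin l))‖ₑ ^ 2

lemma norm_sq_le_of_invStretch_ne_top {l m k : ℕ} {Ψ : Matrix (Fin l) (Fin m) ℝ}
    {Y : Matrix (Fin m) (Fin k) ℝ} (h : invStretch Ψ Y ≠ ∞) (c : Fin k → ℝ) :
    ‖(WithLp.toLp 2 (Y *ᵥ c) : EuclideanSpace ℝ (Fin m))‖ ^ 2 ≤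
      (invStretch Ψ Y).toReal *
        ‖(WithLp.toLp 2 (Ψ *ᵥ (Y *ᵥ c)) : EuclideanSpace ℝ (Fin l))‖ ^ 2 := by
  refine (TopologicalSpace.denseRange_denseSeq (Fin k → ℝ)).induction_on
    (p := fun c => ‖(WithLp.toLp 2 (Y *ᵥ c) : EuclideanSpace ℝ (Fin m))‖ ^ 2 ≤
      (invStretch Ψ Y).toReal *
        ‖(WithLp.toLp 2 (Ψ *ᵥ (Y *ᵥ c)) : EuclideanSpace ℝ (Fin l))‖ ^ 2) c ?_ fun j => ?_
  · exact isClosed_le (by fun_prop) (by fun_prop)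
  · set a := (WithLp.toLp 2 (Y *ᵥ TopologicalSpace.denseSeq (Fin k → ℝ) j) :
      EuclideanSpace ℝ (Fin m))
    set b := (WithLp.toLp 2 (Ψ *ᵥ (Y *ᵥ TopologicalSpace.denseSeq (Fin k → ℝ) j)) :
      EuclideanSpace ℝ (Fin l))
    have hle : ‖a‖ₑ ^ 2 / ‖b‖ₑ ^ 2 ≤ invStretch Ψ Y := le_iSup (fun j =>
      ‖(WithLp.toLp 2 (Y *ᵥ TopologicalSpace.denseSeq (Fin k → ℝ) j) :
      EuclideanSpace ℝ (Fin m))‖ₑ ^ 2 /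
    ‖(WithLp.toLp 2 (Ψ *ᵥ (Y *ᵥ TopologicalSpace.denseSeq (Fin k → ℝ) j)) :
      EuclideanSpace ℝ (Fin l))‖ₑ ^ 2) j
    have h2 : ‖a‖ₑ ^ 2 ≤ invStretch Ψ Y * ‖b‖ₑ ^ 2 := by
      rcases eq_or_ne b 0 with hb | hb
      · rcases eq_or_ne a 0 with ha | ha
        · simp [ha]
        · refine absurd (top_le_iff.1 (le_trans (le_of_eq ?_) hle)) h
          rw [hb, enorm_zero, zero_pow two_ne_zero, ENNReal.div_zero]
          simpa using ha
      · rwa [ENNReal.div_le_iff (by simpa using hb) (by finiteness)] at hle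
    have h3 := ENNReal.toReal_mono (by finiteness) h2
    simpa [ENNReal.toReal_mul, ENNReal.toReal_pow] using h3

/-- A Gaussian matrix with at least two rows more than the rank of `Y` is injective on the range of
`Y`, with a second moment bound on the inverse that does not depend on `Y`. -/
theorem lintegral_invStretch_le {l m k : ℕ} (Y : Matrix (Fin m) (Fin k) ℝ) (hl : Y.rank + 2 ≤ l) :
    ∫⁻ x, invStretch (toMatrix x : Matrix (Fin l) (Fin m) ℝ) Y ∂gaussianPi (Fin l × Fin m) ≤
      l * negMoment ^ 3 := by
  classical
  set T := LinearMap.range (toLpLin 2 2 Y)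
  have hT : Module.finrank ℝ T = Y.rank :=
    (Matrix.rank_eq_finrank_range_toLin Y (EuclideanSpace.basisFun _ ℝ).toBasis
      (EuclideanSpace.basisFun _ ℝ).toBasis).symm ▸ by
      congr 1
  set b := stdOrthonormalBasis ℝ T
  set q : Fin (Module.finrank ℝ T) → EuclideanSpace ℝ (Fin m) := fun i => b i
  have hq : Orthonormal ℝ q := b.orthonormal.comp_linearIsometry T.subtypeₗᵢ
  have key : ∀ x, invStretch (toMatrix x : Matrix (Fin l) (Fin m) ℝ) Y ≤
      ∑ i, (columnDist q i (toMatrix x : Matrix (Fin l) (Fin m) ℝ) ^ 2)⁻¹ := by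
    intro x
    refine iSup_le fun jj => ?_
    set c := TopologicalSpace.denseSeq (Fin k → ℝ) jj
    set y : T := ⟨toLpLin 2 2 Y (WithLp.toLp 2 c), LinearMap.mem_range_self _ _⟩
    set s : Fin (Module.finrank ℝ T) → ℝ := fun i => ⟪b i, y⟫
    have hy : (WithLp.toLp 2 (Y *ᵥ c) : EuclideanSpace ℝ (Fin m)) = ∑ i, s i • q i := by
      have := congrArg Subtype.val (b.sum_repr' y)
      rw [Submodule.coe_sum] at this
      exact this.symm
    have hnorm : ‖(WithLp.toLp 2 (Y *ᵥ c) : EuclideanSpace ℝ (Fin m))‖ₑ ^ 2 =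
        ∑ i, ‖s i‖ₑ ^ 2 := by
      have h := b.sum_sq_norm_inner_right y
      have h' : ‖(WithLp.toLp 2 (Y *ᵥ c) : EuclideanSpace ℝ (Fin m))‖ = ‖y‖ := by
        simp [y, toLpLin_apply]
      simp_rw [← ofReal_norm]
      rw [h', ← ENNReal.ofReal_pow (norm_nonneg _), ← h, ENNReal.ofReal_sum_of_nonneg
        (fun _ _ => sq_nonneg _)]
      simp_rw [← ENNReal.ofReal_pow (norm_nonneg _)]
      rfl
    have himg : (WithLp.toLp 2 (toMatrix x *ᵥ (Y *ᵥ c)) : EuclideanSpace ℝ (Fin l)) =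
        ∑ i, s i • WithLp.toLp 2 (toMatrix x *ᵥ (q i).ofLp) := by
      have := congrArg (toLpLin 2 2 (toMatrix x : Matrix (Fin l) (Fin m) ℝ)) hy
      simpa [toLpLin_apply] using this
    rw [hnorm, div_eq_mul_inv, Finset.sum_mul]
    refine Finset.sum_le_sum fun i _ => ?_
    rw [← div_eq_mul_inv, div_eq_mul_inv, ENNReal.inv_pow, ENNReal.inv_pow, ← mul_pow,
      ← div_eq_mul_inv]
    refine pow_le_pow_left' ?_ 2
    set β := (WithLp.toLp 2 (toMatrix x *ᵥ (Y *ᵥ c)) : EuclideanSpace ℝ (Fin l))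
    rcases eq_or_ne (s i) 0 with h0 | h0
    · simp [h0]
    -- The `i`-th term of `β` is `s i` times the difference of a column and an element of the span
    -- of the other columns.
    have hdist : columnDist q i (toMatrix x : Matrix (Fin l) (Fin m) ℝ) ≤
        ‖β‖ₑ / ‖s i‖ₑ := by
      refine (iInf_le _ (fun j : {j // j ≠ i} => -((s i)⁻¹ * s j))).trans (le_of_eq ?_)
      rw [ENNReal.eq_div_iff (by simpa using h0) (by finiteness), ← enorm_smul]
      congr 1
      rw [himg, Fintype.sum_eq_add_sum_subtype_ne _ i, smul_sub, Finset.smul_sum, sub_eq_add_neg,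
        ← Finset.sum_neg_distrib]
      refine congrArg _ (Finset.sum_congr rfl fun j _ => ?_)
      rw [smul_smul, ← neg_smul]
      congr 1
      field_simp
    rw [← ENNReal.inv_div (by simp) (by simp [h0])]
    exact ENNReal.inv_le_inv.2 hdist
  calc _ ≤ ∫⁻ x, ∑ i, (columnDist q i (toMatrix x : Matrix (Fin l) (Fin m) ℝ) ^ 2)⁻¹
        ∂gaussianPi (Fin l × Fin m) := lintegral_mono key
    _ = ∑ i, ∫⁻ x, (columnDist q i (toMatrix x : Matrix (Fin l) (Fin m) ℝ) ^ 2)⁻¹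
        ∂gaussianPi (Fin l × Fin m) :=
      lintegral_finsetSum _ fun i _ => ((measurable_columnDist q i).pow_const 2).inv
    _ ≤ ∑ _i : Fin (Module.finrank ℝ T), negMoment ^ 3 :=
      Finset.sum_le_sum fun i _ => lintegral_columnDist_le hq (by simpa [hT] using hl) i
    _ ≤ l * negMoment ^ 3 := by
      rw [Finset.sum_const, nsmul_eq_mul, Finset.card_univ, Fintype.card_fin, hT]
      gcongr
      omega

/-! ### The error of a reconstruction for fixed test matrices -/

section reconstruction

variable {m n k l : ℕ}

/-- An operator norm bound for `A` bounds the Frobenius norm of `A * B`. -/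
lemma norm_mul_le_of_mulVec {A : Matrix (Fin m) (Fin n) ℝ} {c : ℝ} (hc : 0 ≤ c)
    (h : ∀ x, ‖WithLp.toLp 2 (A *ᵥ x)‖ ≤ c * ‖WithLp.toLp 2 x‖) (B : Matrix (Fin n) (Fin k) ℝ) :
    ‖A * B‖ ≤ c * ‖B‖ := by
  refine abs_le_of_sq_le_sq' ?_ (by positivity) |>.2
  rw [mul_pow, norm_sq_eq_sum_cols, norm_sq_eq_sum_cols, Finset.mul_sum]
  refine Finset.sum_le_sum fun b _ => ?_
  rw [← mul_pow]
  exact pow_le_pow_left₀ (norm_nonneg _) (h fun a => B a b) 2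

lemma norm_toLp_sq (x : Fin m → ℝ) : ‖WithLp.toLp 2 x‖ ^ 2 = x ⬝ᵥ x := by
  rw [EuclideanSpace.real_norm_sq_eq]; simp [dotProduct, sq]

lemma norm_mulVec_le_of_projection {P : Matrix (Fin m) (Fin m) ℝ} (h1 : Pᵀ = P) (h2 : P * P = P)
    (x : Fin m → ℝ) : ‖WithLp.toLp 2 (P *ᵥ x)‖ ≤ ‖WithLp.toLp 2 x‖ := by
  have h : ‖WithLp.toLp 2 (P *ᵥ x)‖ ^ 2 = ⟪WithLp.toLp 2 x, WithLp.toLp 2 (P *ᵥ x)⟫ := by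
    rw [norm_toLp_sq, EuclideanSpace.inner_toLp_toLp, star_trivial, dotProduct_mulVec,
      ← mulVec_transpose, h1, mulVec_mulVec, h2]
  have h3 := real_inner_le_norm (WithLp.toLp 2 x) (WithLp.toLp 2 (P *ᵥ x))
  rw [← h, sq] at h3
  rcases (norm_nonneg (WithLp.toLp 2 (P *ᵥ x))).eq_or_lt with h0 | h0
  · rw [← h0]; exact norm_nonneg _
  · exact le_of_mul_le_mul_right h3 h0

lemma norm_mulVec_of_transpose_mul_self {Q : Matrix (Fin m) (Fin k) ℝ} (hQ : Qᵀ * Q = 1)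
    (x : Fin k → ℝ) : ‖WithLp.toLp 2 (Q *ᵥ x)‖ = ‖WithLp.toLp 2 x‖ := by
  rw [← sq_eq_sq₀ (norm_nonneg _) (norm_nonneg _), norm_toLp_sq, norm_toLp_sq, dotProduct_mulVec,
    ← mulVec_transpose, mulVec_mulVec, hQ, one_mulVec]

/-- The reconstruction is quasi-optimal: its distance to any matrix `N` of rank at most `r` is
controlled by the distance of `X` to `N` and by how well the columns of `X * Om` span those of
`X`, provided `Ps` does not shrink the range of `X * Om` too much. The matrix `N` does not have to
be a best approximation of `X`. -/
theorem norm_reconstruction_sub_le {r : ℕ} {X Xhat N : Matrix (Fin m) (Fin n) ℝ}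
    {Om : Matrix (Fin n) (Fin k) ℝ} {Ps : Matrix (Fin l) (Fin m) ℝ}
    (h : IsReconstruction r Ps (X * Om) (Ps * X) Xhat) {K : ℝ} (hK0 : 0 ≤ K)
    (hK : ∀ c, ‖WithLp.toLp 2 ((X * Om) *ᵥ c)‖ ^ 2 ≤
      K * ‖WithLp.toLp 2 (Ps *ᵥ ((X * Om) *ᵥ c))‖ ^ 2)
    (hN : N.rank ≤ r) (M : Matrix (Fin k) (Fin n) ℝ) :
    ‖Xhat - N‖ ≤ 2 * (‖X - N‖ + ‖X - X * Om * M‖ * (1 + √K * ‖Ps‖)) := by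
  obtain ⟨q, Q, G, Br, ⟨hQ, hrange⟩, ⟨hG1, hG2, hG3, hG4⟩, ⟨hBr, hbest⟩, rfl⟩ := h
  have hQx := norm_mulVec_of_transpose_mul_self hQ
  have hPsym : (Q * Qᵀ)ᵀ = Q * Qᵀ := by simp
  have hPidem : Q * Qᵀ * (Q * Qᵀ) = Q * Qᵀ := by
    rw [Matrix.mul_assoc, ← Matrix.mul_assoc Qᵀ, hQ, Matrix.one_mul]
  have hQmul : ∀ {p : ℕ} (B : Matrix (Fin q) (Fin p) ℝ), ‖Q * B‖ ≤ ‖B‖ := fun B => by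
    simpa using norm_mul_le_of_mulVec zero_le_one (fun x => by rw [one_mul, hQx]) B
  have hQtmul : ∀ {p : ℕ} (B : Matrix (Fin m) (Fin p) ℝ), ‖Qᵀ * B‖ ≤ ‖B‖ := fun B => by
    refine (norm_mul_le_of_mulVec zero_le_one (fun x => ?_) B).trans_eq (one_mul _)
    rw [one_mul, ← hQx, mulVec_mulVec]
    exact norm_mulVec_le_of_projection hPsym hPidem x
  -- The range of `Q` is the range of the sketch, so `Ps` is bounded below on it.
  have hlow : ∀ w, ‖WithLp.toLp 2 w‖ ≤ √K * ‖WithLp.toLp 2 (Ps *ᵥ (Q *ᵥ w))‖ := fun w => by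
    have hmem : Q *ᵥ w ∈ LinearMap.range (X * Om).mulVecLin := hrange ▸ ⟨w, rfl⟩
    obtain ⟨c, hc⟩ := hmem
    have h1 := hK c
    rw [mulVecLin_apply] at hc
    rw [hc, hQx] at h1
    refine abs_le_of_sq_le_sq' ?_ (by positivity) |>.2
    rwa [mul_pow, Real.sq_sqrt hK0]
  have hGPQ : G * Ps * Q = 1 := by
    refine Matrix.ext_of_mulVec_single fun i => ?_
    have h1 := hlow ((G * Ps * Q) *ᵥ Pi.single i 1 -
      (1 : Matrix (Fin q) (Fin q) ℝ) *ᵥ Pi.single i 1)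
    have h2 : Ps *ᵥ (Q *ᵥ ((G * Ps * Q) *ᵥ Pi.single i 1 -
        (1 : Matrix (Fin q) (Fin q) ℝ) *ᵥ Pi.single i 1)) = 0 := by
      rw [← sub_mulVec, mulVec_mulVec, mulVec_mulVec, Matrix.mul_sub, Matrix.mul_one]
      simp only [← Matrix.mul_assoc] at hG1 ⊢
      rw [hG1, sub_self, zero_mulVec]
    rw [h2, WithLp.toLp_zero, norm_zero, mul_zero, norm_le_zero_iff] at h1
    exact sub_eq_zero.1 (congrArg WithLp.ofLp h1)
  have hGmul : ∀ B : Matrix (Fin l) (Fin n) ℝ, ‖G * B‖ ≤ √K * ‖B‖ := fun B => by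
    refine norm_mul_le_of_mulVec (Real.sqrt_nonneg K) (fun x => (hlow _).trans ?_) B
    rw [mulVec_mulVec, mulVec_mulVec]
    refine mul_le_mul_of_nonneg_left (norm_mulVec_le_of_projection hG3 ?_ x) (Real.sqrt_nonneg K)
    rw [← Matrix.mul_assoc, hG1]
  have hPY : Q * Qᵀ * (X * Om) = X * Om := by
    refine Matrix.ext_of_mulVec_single fun i => ?_
    have hmem : (X * Om) *ᵥ Pi.single i 1 ∈ LinearMap.range Q.mulVecLin := hrange ▸ ⟨_, rfl⟩
    obtain ⟨w, hw⟩ := hmem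
    rw [mulVecLin_apply] at hw
    rw [← mulVec_mulVec, ← hw, mulVec_mulVec, Matrix.mul_assoc, hQ, Matrix.mul_one]
  set δ := ‖X - X * Om * M‖
  have hδ : ‖X - Q * Qᵀ * X‖ ≤ δ := by
    have he : X - Q * Qᵀ * X = (1 - Q * Qᵀ) * (X - X * Om * M) := by
      rw [Matrix.sub_mul, Matrix.one_mul, Matrix.mul_sub, ← Matrix.mul_assoc _ _ M, hPY]
      abel
    rw [he]
    refine (norm_mul_le_of_mulVec zero_le_one (fun x => ?_) _).trans_eq (one_mul _)
    rw [one_mul]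
    refine norm_mulVec_le_of_projection ?_ ?_ x
    · rw [transpose_sub, transpose_one, hPsym]
    · rw [Matrix.sub_mul, Matrix.one_mul, Matrix.mul_sub, Matrix.mul_one, hPidem, sub_self,
        sub_zero]
  have hB : ‖G * (Ps * X) - Qᵀ * X‖ ≤ √K * (‖Ps‖ * δ) := by
    have he : G * (Ps * X) - Qᵀ * X = G * (Ps * (X - Q * Qᵀ * X)) := by
      rw [Matrix.mul_sub, Matrix.mul_sub]
      congr 1
      simp only [← Matrix.mul_assoc]
      rw [hGPQ, Matrix.one_mul]
    rw [he]
    refine (hGmul _).trans (mul_le_mul_of_nonneg_left ?_ (Real.sqrt_nonneg K))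
    exact (frobenius_norm_mul _ _).trans (mul_le_mul_of_nonneg_left hδ (norm_nonneg _))
  have hQB : ‖Q * (G * (Ps * X)) - N‖ ≤ ‖X - N‖ + δ * (1 + √K * ‖Ps‖) := by
    have he : Q * (G * (Ps * X)) - N =
        Q * (G * (Ps * X) - Qᵀ * X) - (X - Q * Qᵀ * X) + (X - N) := by
      rw [Matrix.mul_sub, Matrix.mul_assoc Q Qᵀ X]; abel
    calc _ ≤ ‖Q * (G * (Ps * X) - Qᵀ * X)‖ + ‖X - Q * Qᵀ * X‖ + ‖X - N‖ := by
          rw [he]; exact (norm_add_le _ _).trans (by gcongr; exact norm_sub_le _ _)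
      _ ≤ √K * (‖Ps‖ * δ) + δ + ‖X - N‖ := by
          gcongr; exact (hQmul _).trans hB
      _ = _ := by ring
  have hBN : ‖G * (Ps * X) - Br‖ ≤ ‖Q * (G * (Ps * X)) - N‖ := by
    refine (hbest (Qᵀ * N) ((rank_mul_le_right _ _).trans hN)).trans ?_
    have he : G * (Ps * X) - Qᵀ * N = Qᵀ * (Q * (G * (Ps * X)) - N) := by
      rw [Matrix.mul_sub, ← Matrix.mul_assoc Qᵀ Q, hQ, Matrix.one_mul]
    rw [he]; exact hQtmul _
  have he : Q * Br - N = (Q * (G * (Ps * X)) - N) - Q * (G * (Ps * X) - Br) := by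
    rw [Matrix.mul_sub]; abel
  calc ‖Q * Br - N‖ ≤ ‖Q * (G * (Ps * X)) - N‖ + ‖Q * (G * (Ps * X) - Br)‖ := by
        rw [he]; exact norm_sub_le _ _
    _ ≤ ‖Q * (G * (Ps * X)) - N‖ + ‖Q * (G * (Ps * X)) - N‖ := by
        gcongr; exact (hQmul _).trans hBN
    _ ≤ _ := by linarith

end reconstruction

/-! ### The expected error of the reconstruction -/

section expectation

variable {m n k l : ℕ}

lemma lintegral_norm_sq_lt_top :
    ∫⁻ x, ‖(toMatrix x : Matrix (Fin l) (Fin m) ℝ)‖ₑ ^ 2 ∂gaussianPi (Fin l × Fin m) < ∞ := by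
  have h : ∀ x : Fin l × Fin m → ℝ, ‖(toMatrix x : Matrix (Fin l) (Fin m) ℝ)‖ₑ ^ 2 =
      ∑ p, ‖x p‖ₑ ^ 2 := fun x => by
    rw [← ofReal_norm, ← ENNReal.ofReal_pow (norm_nonneg _), norm_sq_eq_sum,
      ← Fintype.sum_prod_type' (f := fun i j => (toMatrix x : Matrix (Fin l) (Fin m) ℝ) i j ^ 2),
      ENNReal.ofReal_sum_of_nonneg fun _ _ => sq_nonneg _]
    refine Finset.sum_congr rfl fun p _ => ?_
    rw [← ofReal_norm, ← ENNReal.ofReal_pow (norm_nonneg _), Real.norm_eq_abs, sq_abs]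
    rfl
  simp_rw [h]
  rw [lintegral_finsetSum _ fun p _ => by fun_prop]
  refine ENNReal.sum_lt_top.2 fun p _ => ?_
  have h1 : ∫⁻ x, ‖x p‖ₑ ^ 2 ∂gaussianPi (Fin l × Fin m) =
      ∫⁻ y, ‖y‖ₑ ^ 2 ∂gaussianReal 0 1 :=
    (measurePreserving_eval (fun _ : Fin l × Fin m => gaussianReal 0 1) p).lintegral_comp
      (f := fun y => ‖y‖ₑ ^ 2) (by fun_prop)
  rw [h1]
  have h2 := (memLp_id_gaussianReal (μ := 0) (v := 1) 2).eLpNorm_lt_top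
  have h3 := (eLpNorm_lt_top_iff_lintegral_rpow_enorm_lt_top (by simp) (by simp)).1 h2
  simpa using h3

lemma measurable_invStretch {Z : Type*} [TopologicalSpace Z] [MeasurableSpace Z]
    [OpensMeasurableSpace Z] {g : Z → Matrix (Fin l) (Fin m) ℝ} {Y : Z → Matrix (Fin m) (Fin k) ℝ}
    (hg : Continuous g) (hY : Continuous Y) : Measurable fun z => invStretch (g z) (Y z) := by
  refine Measurable.iSup fun j => Measurable.div (Measurable.pow_const ?_ 2)
    (Measurable.pow_const ?_ 2) <;> refine Continuous.measurable (Continuous.enorm ?_)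
  · exact (PiLp.continuous_toLp 2 _).comp (hY.matrix_mulVec continuous_const)
  · exact (PiLp.continuous_toLp 2 _).comp (hg.matrix_mulVec (hY.matrix_mulVec continuous_const))

/-- How well the columns of `X * Om` span those of `X`. -/
def rangeError (X : Matrix (Fin m) (Fin n) ℝ) (Om : Matrix (Fin n) (Fin k) ℝ) : ℝ≥0∞ :=
  ⨅ M : Matrix (Fin k) (Fin n) ℝ, ‖X - X * Om * M‖ₑ

lemma measurable_rangeError (X : Matrix (Fin m) (Fin n) ℝ) :
    Measurable fun y : Fin n × Fin k → ℝ => rangeError X (toMatrix y) := by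
  refine UpperSemicontinuous.measurable (upperSemicontinuous_iInf fun M =>
    Continuous.upperSemicontinuous (Continuous.enorm ?_))
  exact continuous_const.sub
    ((continuous_const.matrix_mul continuous_toMatrix).matrix_mul continuous_const)

lemma rangeError_le (X : Matrix (Fin m) (Fin n) ℝ) (Om : Matrix (Fin n) (Fin k) ℝ) :
    rangeError X Om ≤ ‖X‖ₑ :=
  (iInf_le _ 0).trans_eq (by simp)

/-- If `M` certifies that `N * Om` has the range of `N`, the same `M` shows that the range error
vanishes along any sequence that converges to `N`. -/
lemma tendsto_rangeError {X : ℕ → Matrix (Fin m) (Fin n) ℝ} {N : Matrix (Fin m) (Fin n) ℝ}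
    (hX : Tendsto X atTop (𝓝 N)) {Om : Matrix (Fin n) (Fin k) ℝ} {M : Matrix (Fin k) (Fin n) ℝ}
    (hM : N * Om * M = N) : Tendsto (fun j => rangeError (X j) Om) atTop (𝓝 0) := by
  have hc : Continuous fun Z : Matrix (Fin m) (Fin n) ℝ => ‖Z - Z * Om * M‖ₑ :=
    Continuous.enorm (continuous_id.sub
      ((continuous_id.matrix_mul continuous_const).matrix_mul continuous_const))
  have h := (hc.tendsto N).comp hX
  have h0 : ‖N - N * Om * M‖ₑ = 0 := by rw [hM, sub_self, ← ofReal_norm, norm_zero]; simp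
  rw [h0] at h
  exact tendsto_of_tendsto_of_tendsto_of_le_of_le tendsto_const_nhds h (fun _ => zero_le)
    fun j => iInf_le _ M

/-- If `Omᵀ` is injective on the range of `Nᵀ`, then `N * Om` has the rank of `N`, hence also its
range. -/
lemma exists_mul_mul_eq_of_injOn {N : Matrix (Fin m) (Fin n) ℝ} {Om : Matrix (Fin n) (Fin k) ℝ}
    (h : ∀ c, Omᵀ *ᵥ (Nᵀ *ᵥ c) = 0 → Nᵀ *ᵥ c = 0) :
    ∃ M : Matrix (Fin k) (Fin n) ℝ, N * Om * M = N := by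
  have hker : LinearMap.ker (Omᵀ * Nᵀ).mulVecLin = LinearMap.ker Nᵀ.mulVecLin := by
    ext c
    simp only [LinearMap.mem_ker, mulVecLin_apply, ← mulVec_mulVec]
    exact ⟨h c, fun hc => by rw [hc, mulVec_zero]⟩
  have h1 := LinearMap.finrank_range_add_finrank_ker (Omᵀ * Nᵀ).mulVecLin
  have h2 := LinearMap.finrank_range_add_finrank_ker Nᵀ.mulVecLin
  have hrank : (N * Om).rank = N.rank := by
    rw [← rank_transpose (N * Om), ← rank_transpose N, transpose_mul]
    unfold Matrix.rank
    rw [hker] at h1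
    omega
  have hle : LinearMap.range (N * Om).mulVecLin ≤ LinearMap.range N.mulVecLin := by
    rintro _ ⟨c, rfl⟩
    exact ⟨Om *ᵥ c, by simp⟩
  have heq := Submodule.eq_of_le_of_finrank_eq hle hrank
  have hcol : ∀ i, ∃ c, (N * Om) *ᵥ c = N *ᵥ Pi.single i 1 := fun i => by
    have : N *ᵥ Pi.single i 1 ∈ LinearMap.range (N * Om).mulVecLin := heq ▸ ⟨_, rfl⟩
    exact this
  choose c hc using hcol
  refine ⟨of fun a i => c i a, Matrix.ext_of_mulVec_single fun i => ?_⟩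
  have hi : (of fun a i => c i a) *ᵥ Pi.single i 1 = c i := by ext a; simp
  rw [← mulVec_mulVec, hi, hc]

lemma measurePreserving_swap_gaussianPi (ι κ : Type*) [Fintype ι] [Fintype κ] :
    MeasurePreserving (fun (x : ι × κ → ℝ) (p : κ × ι) => x p.swap)
      (gaussianPi (ι × κ)) (gaussianPi (κ × ι)) := by
  classical
  have h := measurePreserving_inner_orthonormal
    ((EuclideanSpace.basisFun (ι × κ) ℝ).orthonormal.comp (Prod.swap : κ × ι → ι × κ)
      Prod.swap_injective)
  convert h using 3 with x p
  simp [EuclideanSpace.inner_single_left]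

/-- Almost surely, sketching with `2 * r + 1` Gaussian vectors preserves the range of a fixed matrix
of rank at most `r`. -/
lemma ae_exists_mul_mul_eq {r : ℕ} {N : Matrix (Fin m) (Fin n) ℝ} (hN : N.rank ≤ r) :
    ∀ᵐ y ∂gaussianPi (Fin n × Fin (2 * r + 1)),
      ∃ M : Matrix (Fin (2 * r + 1)) (Fin n) ℝ, N * toMatrix y * M = N := by
  rcases Nat.eq_zero_or_pos r with rfl | hr
  · have h0 : N = 0 := by
      rw [Nat.le_zero, Matrix.rank, Submodule.finrank_eq_zero, LinearMap.range_eq_bot] at hN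
      refine Matrix.ext_of_mulVec_single fun i => ?_
      rw [← mulVecLin_apply, hN, LinearMap.zero_apply, zero_mulVec]
    exact Eventually.of_forall fun y => ⟨0, by rw [h0, Matrix.mul_zero]⟩
  have h1 := lintegral_invStretch_le (l := 2 * r + 1) Nᵀ (by rw [rank_transpose]; omega)
  have hm : Measurable fun x : Fin (2 * r + 1) × Fin n → ℝ => invStretch (toMatrix x) Nᵀ :=
    measurable_invStretch continuous_toMatrix continuous_const
  have h2 := ae_lt_top hm (h1.trans_lt (by
    have := negMoment_lt_top
    finiteness)).ne
  have h3 :=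
    (measurePreserving_swap_gaussianPi (Fin n) (Fin (2 * r + 1))).quasiMeasurePreserving.ae h2
  filter_upwards [h3] with y hy
  refine exists_mul_mul_eq_of_injOn fun c hc => ?_
  have h4 := norm_sq_le_of_invStretch_ne_top hy.ne c
  have h5 : (toMatrix fun p : Fin (2 * r + 1) × Fin n => y p.swap) = (toMatrix y)ᵀ := rfl
  rw [h5, hc, WithLp.toLp_zero, norm_zero, zero_pow two_ne_zero, mul_zero] at h4
  have h6 : WithLp.toLp 2 (Nᵀ *ᵥ c) = 0 := by
    rw [← norm_eq_zero]; exact pow_eq_zero_iff two_ne_zero |>.1 (le_antisymm h4 (sq_nonneg _))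
  exact congrArg WithLp.ofLp h6

lemma toMatrix_entries (M : Matrix (Fin m) (Fin n) ℝ) : toMatrix (fun p => M p.1 p.2) = M := rfl

lemma measurable_enorm_toMatrix :
    Measurable fun x : Fin l × Fin m → ℝ => ‖(toMatrix x : Matrix (Fin l) (Fin m) ℝ)‖ₑ := by
  refine Continuous.measurable (Continuous.enorm ?_)
  exact continuous_toMatrix

lemma IsStandardNormalPair.aemeasurable {S : Type*} [MeasurableSpace S] {P : Measure S}
    {Om : S → Matrix (Fin n) (Fin k) ℝ} {Ps : S → Matrix (Fin l) (Fin m) ℝ}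
    (h : IsStandardNormalPair P Om Ps) :
    AEMeasurable (fun s =>
      ((fun p : Fin n × Fin k => Om s p.1 p.2), (fun p : Fin l × Fin m => Ps s p.1 p.2))) P :=
  (aemeasurable_pi_lambda _ fun p : Fin n × Fin k => (h.1 p.1 p.2).aemeasurable).prodMk
    (aemeasurable_pi_lambda _ fun p : Fin l × Fin m => (h.2.1 p.1 p.2).aemeasurable)

/-- The joint law of a pair of independent standard normal matrices, as a change of variables. -/
lemma IsStandardNormalPair.lintegral_comp {S : Type*} [MeasurableSpace S] {P : Measure S}
    [IsProbabilityMeasure P] {Om : S → Matrix (Fin n) (Fin k) ℝ}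
    {Ps : S → Matrix (Fin l) (Fin m) ℝ} (h : IsStandardNormalPair P Om Ps)
    {F : (Fin n × Fin k → ℝ) × (Fin l × Fin m → ℝ) → ℝ≥0∞} (hF : Measurable F) :
    ∫⁻ s, F (fun p => Om s p.1 p.2, fun p => Ps s p.1 p.2) ∂P =
      ∫⁻ y, ∫⁻ x, F (y, x) ∂gaussianPi (Fin l × Fin m) ∂gaussianPi (Fin n × Fin k) := by
  obtain ⟨hO, hP, hI⟩ := h
  set Z : (Fin n × Fin k) ⊕ (Fin l × Fin m) → S → ℝ := fun e s =>
    Sum.elim (fun p => Om s p.1 p.2) (fun p => Ps s p.1 p.2) e with hZ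
  have hlaw : ∀ e, HasLaw (Z e) (gaussianReal 0 1) P := by
    rintro (p | p)
    · exact hO p.1 p.2
    · exact hP p.1 p.2
  have hZm : AEMeasurable (fun s e => Z e s) P := aemeasurable_pi_lambda _ fun e =>
    (hlaw e).aemeasurable
  have hmap : P.map (fun s e => Z e s) = gaussianPi ((Fin n × Fin k) ⊕ (Fin l × Fin m)) := by
    rw [(iIndepFun_iff_map_fun_eq_pi_map fun e => (hlaw e).aemeasurable).1 hI, gaussianPi]
    congr 1
    ext1 e
    exact (hlaw e).map_eq
  have mp := measurePreserving_gaussianPi_sum (Fin n × Fin k) (Fin l × Fin m)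
  have hint := lintegral_map' (hF.comp mp.measurable).aemeasurable hZm
  rw [hmap] at hint
  rw [← lintegral_prod _ hF.aemeasurable, ← mp.lintegral_comp hF]
  exact hint.symm

/-- For fixed test matrices the error of the reconstruction is bounded by a measurable function of
the test matrices. -/
lemma enorm_reconstruction_sub_le {r : ℕ} {X Xhat N : Matrix (Fin m) (Fin n) ℝ}
    {Om : Matrix (Fin n) (Fin k) ℝ} {Ps : Matrix (Fin l) (Fin m) ℝ}
    (h : IsReconstruction r Ps (X * Om) (Ps * X) Xhat) (hfin : invStretch Ps (X * Om) ≠ ∞)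
    (hN : N.rank ≤ r) :
    ‖Xhat - N‖ₑ ≤
      2 * (‖X - N‖ₑ + rangeError X Om * (1 + (invStretch Ps (X * Om) + ‖Ps‖ₑ ^ 2))) := by
  have hc0 : 1 + (invStretch Ps (X * Om) + ‖Ps‖ₑ ^ 2) ≠ 0 := by simp
  have hct : 1 + (invStretch Ps (X * Om) + ‖Ps‖ₑ ^ 2) ≠ ∞ := by finiteness
  rw [rangeError, ENNReal.iInf_mul_of_ne hc0 hct, ENNReal.add_iInf,
    ENNReal.mul_iInf_of_ne (by simp) (by simp)]
  refine le_iInf fun M => ?_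
  set K := (invStretch Ps (X * Om)).toReal
  have h1 := norm_reconstruction_sub_le h ENNReal.toReal_nonneg
    (norm_sq_le_of_invStretch_ne_top hfin) hN M
  have h2 : √K * ‖Ps‖ ≤ K + ‖Ps‖ ^ 2 := by
    nlinarith [Real.sq_sqrt (ENNReal.toReal_nonneg : 0 ≤ K), sq_nonneg (√K - ‖Ps‖),
      sq_nonneg (√K), sq_nonneg ‖Ps‖]
  have hK : ENNReal.ofReal K = invStretch Ps (X * Om) := ENNReal.ofReal_toReal hfin
  have hK0 : 0 ≤ K := ENNReal.toReal_nonneg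
  calc ‖Xhat - N‖ₑ = ENNReal.ofReal ‖Xhat - N‖ := (ofReal_norm _).symm
    _ ≤ ENNReal.ofReal (2 * (‖X - N‖ + ‖X - X * Om * M‖ * (1 + (K + ‖Ps‖ ^ 2)))) := by
      refine ENNReal.ofReal_le_ofReal (h1.trans ?_)
      gcongr
    _ = _ := by
      rw [ENNReal.ofReal_mul (by norm_num), ENNReal.ofReal_add (by positivity) (by positivity),
        ENNReal.ofReal_mul (by positivity), ENNReal.ofReal_add (by positivity) (by positivity),
        ENNReal.ofReal_add (by positivity) (by positivity), hK,
        ENNReal.ofReal_pow (by positivity), ofReal_norm, ofReal_norm, ofReal_norm]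
      simp

/-- The constant in the expected error bound, an upper bound for
`𝔼 (1 + 1 / σ_min(Ψ Q) ^ 2 + ‖Ψ‖ ^ 2)` for every orthonormal `Q` with at most `l - 2`
columns. -/
def errorConst (l m : ℕ) : ℝ≥0∞ :=
  1 + (l * negMoment ^ 3 +
    ∫⁻ x, ‖(toMatrix x : Matrix (Fin l) (Fin m) ℝ)‖ₑ ^ 2 ∂gaussianPi (Fin l × Fin m))

lemma errorConst_ne_top (l m : ℕ) : errorConst l m ≠ ∞ := by
  have h1 := negMoment_lt_top
  have h2 := lintegral_norm_sq_lt_top (l := l) (m := m)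
  unfold errorConst
  finiteness

lemma lintegral_const_mul_add_mul {Z : Type*} [MeasurableSpace Z] {μ : Measure Z}
    [IsProbabilityMeasure μ] {g : Z → ℝ≥0∞} (hg : Measurable g) (a b c : ℝ≥0∞) :
    ∫⁻ z, c * (a + g z * b) ∂μ = c * (a + (∫⁻ z, g z ∂μ) * b) := by
  rw [lintegral_const_mul _ (by fun_prop), lintegral_add_left measurable_const,
    lintegral_mul_const _ hg, lintegral_const, measure_univ, mul_one]

/-- The expected error of the reconstruction of a fixed matrix `X`, relative to any matrix of rank
at most `r`. -/
theorem lintegral_reconstruction_error_le {r : ℕ} {S : Type*} [MeasurableSpace S] {P : Measure S}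
    [IsProbabilityMeasure P] {Om : S → Matrix (Fin n) (Fin k) ℝ}
    {Ps : S → Matrix (Fin l) (Fin m) ℝ} (h : IsStandardNormalPair P Om Ps) (hkl : k + 2 ≤ l)
    {X N : Matrix (Fin m) (Fin n) ℝ} {Xhat : S → Matrix (Fin m) (Fin n) ℝ}
    (hX : ∀ᵐ s ∂P, IsReconstruction r (Ps s) (X * Om s) (Ps s * X) (Xhat s)) (hN : N.rank ≤ r) :
    ∫⁻ s, ‖Xhat s - N‖ₑ ∂P ≤ 2 * (‖X - N‖ₑ +
      (∫⁻ y, rangeError X (toMatrix y) ∂gaussianPi (Fin n × Fin k)) * errorConst l m) := by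
  have hKm : Measurable fun p : (Fin n × Fin k → ℝ) × (Fin l × Fin m → ℝ) =>
      invStretch (toMatrix p.2) (X * toMatrix p.1) :=
    measurable_invStretch (continuous_toMatrix.comp continuous_snd)
      (continuous_const.matrix_mul (continuous_toMatrix.comp continuous_fst))
  have hPm : Measurable fun x : Fin l × Fin m → ℝ =>
      ‖(toMatrix x : Matrix (Fin l) (Fin m) ℝ)‖ₑ ^ 2 :=
    measurable_enorm_toMatrix.pow_const 2
  have hKint : ∀ y : Fin n × Fin k → ℝ,
      ∫⁻ x, invStretch (toMatrix x : Matrix (Fin l) (Fin m) ℝ) (X * toMatrix y)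
        ∂gaussianPi (Fin l × Fin m) ≤ l * negMoment ^ 3 := fun y =>
    lintegral_invStretch_le _ ((Nat.add_le_add_right (rank_le_width _) 2).trans hkl)
  have hfin : ∀ᵐ s ∂P, invStretch (Ps s) (X * Om s) ≠ ∞ := by
    have hlt : ∫⁻ s, invStretch (Ps s) (X * Om s) ∂P < ∞ := by
      have hlaw := h.lintegral_comp hKm
      simp only [toMatrix_entries] at hlaw
      rw [hlaw]
      refine (lintegral_mono hKint).trans_lt ?_
      rw [lintegral_const, measure_univ, mul_one]
      have := negMoment_lt_top
      finiteness
    have hae := hKm.comp_aemeasurable h.aemeasurable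
    simp only [Function.comp_def, toMatrix_entries] at hae
    filter_upwards [ae_lt_top' hae hlt.ne] with s hs using hs.ne
  set F : (Fin n × Fin k → ℝ) × (Fin l × Fin m → ℝ) → ℝ≥0∞ := fun p =>
    2 * (‖X - N‖ₑ + rangeError X (toMatrix p.1) *
      (1 + (invStretch (toMatrix p.2) (X * toMatrix p.1) +
        ‖(toMatrix p.2 : Matrix (Fin l) (Fin m) ℝ)‖ₑ ^ 2))) with hF
  have hFm : Measurable F :=
    (measurable_const.add (((measurable_rangeError X).comp measurable_fst).mul
      (measurable_const.add (hKm.add (hPm.comp measurable_snd))))).const_mul 2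
  calc ∫⁻ s, ‖Xhat s - N‖ₑ ∂P
      ≤ ∫⁻ s, F (fun p => Om s p.1 p.2, fun p => Ps s p.1 p.2) ∂P := by
        refine lintegral_mono_ae ?_
        filter_upwards [hX, hfin] with s h1 h2
        simp only [hF, toMatrix_entries]
        exact enorm_reconstruction_sub_le h1 h2 hN
    _ = ∫⁻ y, ∫⁻ x, F (y, x) ∂gaussianPi (Fin l × Fin m) ∂gaussianPi (Fin n × Fin k) :=
        h.lintegral_comp hFm
    _ ≤ ∫⁻ y, 2 * (‖X - N‖ₑ + rangeError X (toMatrix y) * errorConst l m)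
          ∂gaussianPi (Fin n × Fin k) := by
        refine lintegral_mono fun y => ?_
        have hKy : Measurable fun x : Fin l × Fin m → ℝ =>
            invStretch (toMatrix x : Matrix (Fin l) (Fin m) ℝ) (X * toMatrix y) :=
          measurable_invStretch continuous_toMatrix continuous_const
        have hsum : Measurable fun x : Fin l × Fin m → ℝ =>
            1 + (invStretch (toMatrix x : Matrix (Fin l) (Fin m) ℝ) (X * toMatrix y) +
              ‖(toMatrix x : Matrix (Fin l) (Fin m) ℝ)‖ₑ ^ 2) :=
          measurable_const.add (hKy.add hPm)
        simp only [hF, mul_comm (rangeError X _)]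
        rw [lintegral_const_mul_add_mul hsum,
          lintegral_add_left measurable_const, lintegral_add_left hKy, lintegral_const,
          measure_univ, mul_one, errorConst]
        gcongr
        exact hKint y
    _ = _ := lintegral_const_mul_add_mul (measurable_rangeError X) _ _ _

end expectation

/-! ### Convergence of the sketched method -/

section convergence

variable {m n k : ℕ}

lemma aestronglyMeasurable_distF {S : Type*} [MeasurableSpace S] {P : Measure S}
    {Xhat : S → Matrix (Fin m) (Fin n) ℝ} (h : ∀ i j, AEMeasurable (fun s => Xhat s i j) P)
    (T : Set (Matrix (Fin m) (Fin n) ℝ)) : AEStronglyMeasurable (fun s => distF (Xhat s) T) P := by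
  have hc : Measurable fun x : Fin m × Fin n → ℝ => distF (toMatrix x) T := by
    refine Continuous.measurable ((Metric.continuous_infDist_pt T).comp ?_)
    exact continuous_toMatrix
  have hX : AEMeasurable (fun s (p : Fin m × Fin n) => Xhat s p.1 p.2) P :=
    aemeasurable_pi_lambda _ fun p => h p.1 p.2
  exact (hc.comp_aemeasurable hX).aestronglyMeasurable

lemma distF_nonneg (M : Matrix (Fin m) (Fin n) ℝ) (T : Set (Matrix (Fin m) (Fin n) ℝ)) :
    0 ≤ distF M T := Metric.infDist_nonneg

lemma ofReal_distF_le (M : Matrix (Fin m) (Fin n) ℝ) {T : Set (Matrix (Fin m) (Fin n) ℝ)}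
    {N : Matrix (Fin m) (Fin n) ℝ} (hN : N ∈ T) : ENNReal.ofReal (distF M T) ≤ ‖M - N‖ₑ := by
  rw [← ofReal_norm, ← dist_eq_norm]
  exact ENNReal.ofReal_le_ofReal (Metric.infDist_le_dist_of_mem hN)

lemma enorm_le_of_mem_schattenBall {α : ℝ} {X : Matrix (Fin m) (Fin n) ℝ}
    (hX : X ∈ schattenBall m n α) : ‖X‖ₑ ≤ ENNReal.ofReal α := by
  rw [← ofReal_norm]
  exact ENNReal.ofReal_le_ofReal ((norm_le_schattenOneNorm X).trans hX)

lemma lintegral_rangeError_le {α : ℝ} {X : Matrix (Fin m) (Fin n) ℝ}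
    (hX : X ∈ schattenBall m n α) :
    ∫⁻ y, rangeError X (toMatrix y) ∂gaussianPi (Fin n × Fin k) ≤ ENNReal.ofReal α := by
  refine (lintegral_mono fun y =>
    (rangeError_le X _).trans (enorm_le_of_mem_schattenBall hX)).trans_eq ?_
  rw [lintegral_const, measure_univ, mul_one]

/-- Dominated convergence for the range error: along a sequence that converges to a matrix of rank
at most `r`, the expected range error of a sketch with `2 * r + 1` columns vanishes. -/
lemma tendsto_lintegral_rangeError {r : ℕ} {α : ℝ} {X : ℕ → Matrix (Fin m) (Fin n) ℝ}
    {N : Matrix (Fin m) (Fin n) ℝ} (hX : ∀ j, X j ∈ schattenBall m n α)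
    (hlim : Tendsto X atTop (𝓝 N)) (hN : N.rank ≤ r) :
    Tendsto (fun j => ∫⁻ y, rangeError (X j) (toMatrix y)
      ∂gaussianPi (Fin n × Fin (2 * r + 1))) atTop (𝓝 0) := by
  have h := tendsto_lintegral_of_dominated_convergence
    (μ := gaussianPi (Fin n × Fin (2 * r + 1))) (f := fun _ => 0)
    (F := fun j y => rangeError (X j) (toMatrix y)) (fun _ => ENNReal.ofReal α)
    (fun j => measurable_rangeError (X j))
    (fun j => Eventually.of_forall fun y =>
      (rangeError_le (X j) _).trans (enorm_le_of_mem_schattenBall (hX j)))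
    (by simp)
    (by filter_upwards [ae_exists_mul_mul_eq hN] with y ⟨M, hM⟩ using tendsto_rangeError hlim hM)
  simpa using h

variable {d r : ℕ} {f : EuclideanSpace ℝ (Fin d) → ℝ} {A : Fin d → Matrix (Fin m) (Fin n) ℝ}
  {α : ℝ} {u : ℕ → EuclideanSpace ℝ (Fin m)} {v : ℕ → EuclideanSpace ℝ (Fin n)}
  {S : Type*} [MeasurableSpace S] {P : Measure S} [IsProbabilityMeasure P]
  {Om : S → Matrix (Fin n) (Fin (2 * r + 1)) ℝ} {Ps : S → Matrix (Fin (4 * r + 3)) (Fin m) ℝ}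
  {Xhat : ℕ → S → Matrix (Fin m) (Fin n) ℝ}

lemma lintegral_distF_le (hrank : ∀ X ∈ solutionSet f A α, X.rank ≤ r)
    (hnormal : IsStandardNormalPair P Om Ps)
    (hXhat : ∀ t, ∀ᵐ s ∂P, IsReconstruction r (Ps s)
      (rangeSketch α u v (Om s) t) (corangeSketch α u v (Ps s) t) (Xhat t s))
    {N : Matrix (Fin m) (Fin n) ℝ} (hN : N ∈ solutionSet f A α) (t : ℕ) :
    ∫⁻ s, ENNReal.ofReal (distF (Xhat t s) (solutionSet f A α)) ∂P ≤
      2 * (‖xIter α u v t - N‖ₑ +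
        (∫⁻ y, rangeError (xIter α u v t) (toMatrix y) ∂gaussianPi (Fin n × Fin (2 * r + 1))) *
          errorConst (4 * r + 3) m) := by
  refine (lintegral_mono fun s => ofReal_distF_le (Xhat t s) hN).trans ?_
  refine lintegral_reconstruction_error_le hnormal (by omega) ?_ (hrank N hN)
  filter_upwards [hXhat t] with s hs
  rwa [rangeSketch_eq, corangeSketch_eq] at hs

lemma lintegral_distF_lt_top (hα : 0 ≤ α) (hu : ∀ t, ‖u t‖ = 1) (hv : ∀ t, ‖v t‖ = 1)
    (hrank : ∀ X ∈ solutionSet f A α, X.rank ≤ r) (hnormal : IsStandardNormalPair P Om Ps)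
    (hXhat : ∀ t, ∀ᵐ s ∂P, IsReconstruction r (Ps s)
      (rangeSketch α u v (Om s) t) (corangeSketch α u v (Ps s) t) (Xhat t s))
    (hne : (solutionSet f A α).Nonempty) (t : ℕ) :
    ∫⁻ s, ENNReal.ofReal (distF (Xhat t s) (solutionSet f A α)) ∂P < ∞ := by
  obtain ⟨N, hN⟩ := hne
  refine (lintegral_distF_le hrank hnormal hXhat hN t).trans_lt ?_
  have h1 := (lintegral_rangeError_le (k := 2 * r + 1) (xIter_mem hα hu hv t)).trans_lt
    ENNReal.ofReal_lt_top
  have h2 := errorConst_ne_top (4 * r + 3) m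
  have h3 : ‖xIter α u v t - N‖ₑ < ∞ := by rw [← ofReal_norm]; exact ENNReal.ofReal_lt_top
  finiteness

lemma tendsto_lintegral_distF (hf_convex : ConvexOn ℝ Set.univ f) (hf_smooth : ContDiff ℝ 1 f)
    (hα : 0 ≤ α) (hrank : ∀ X ∈ solutionSet f A α, X.rank ≤ r)
    (huv : ∀ t, IsMaxSingVec (measureAdjoint A (gradient f (zIter A α u v t))) (u t) (v t))
    (hnormal : IsStandardNormalPair P Om Ps)
    (hXhat : ∀ t, ∀ᵐ s ∂P, IsReconstruction r (Ps s)
      (rangeSketch α u v (Om s) t) (corangeSketch α u v (Ps s) t) (Xhat t s)) :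
    Tendsto (fun t => ∫⁻ s, ENNReal.ofReal (distF (Xhat t s) (solutionSet f A α)) ∂P) atTop
      (𝓝 0) := by
  have hmem := xIter_mem hα (fun t => (huv t).1) (fun t => (huv t).2.1)
  refine tendsto_of_subseq_tendsto fun ns hns => ?_
  obtain ⟨N, hN, ms, -, hlim⟩ := exists_subseq_tendsto_xIter hf_convex hf_smooth A hα huv hns
  refine ⟨ms, tendsto_of_tendsto_of_tendsto_of_le_of_le tendsto_const_nhds ?_
    (fun _ => zero_le) fun j => lintegral_distF_le hrank hnormal hXhat hN (ns (ms j))⟩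
  have h1 : Tendsto (fun j => ‖xIter α u v (ns (ms j)) - N‖ₑ) atTop (𝓝 0) := by
    have h := ENNReal.tendsto_ofReal (tendsto_iff_norm_sub_tendsto_zero.1 hlim)
    simpa only [ofReal_norm, ENNReal.ofReal_zero] using h
  have h2 := tendsto_lintegral_rangeError (fun j => hmem (ns (ms j))) hlim (hrank N hN)
  have h3 := ENNReal.Tendsto.mul_const h2 (Or.inr (errorConst_ne_top (4 * r + 3) m))
  have h4 := ENNReal.Tendsto.const_mul (a := 2) (h1.add h3) (Or.inr (by simp))
  simpa using h4

end convergence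

end SketchyCGM

end

theorem theorem3 {m n d r : ℕ}
    (f : EuclideanSpace ℝ (Fin d) → ℝ) (hf_convex : ConvexOn ℝ Set.univ f)
    (hf_smooth : ContDiff ℝ 1 f)
    (A : Fin d → Matrix (Fin m) (Fin n) ℝ) (α : ℝ) (hα : 0 ≤ α)
    (hrank : ∀ X ∈ SketchyCGM.solutionSet f A α, X.rank ≤ r)
    -- the maximum singular vectors computed along the iteration
    (u : ℕ → EuclideanSpace ℝ (Fin m)) (v : ℕ → EuclideanSpace ℝ (Fin n))
    (huv : ∀ t, SketchyCGM.IsMaxSingVec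
      (SketchyCGM.measureAdjoint A (gradient f (SketchyCGM.zIter A α u v t))) (u t) (v t))
    -- the random test matrices
    {S : Type*} [MeasurableSpace S] (P : MeasureTheory.Measure S)
    [MeasureTheory.IsProbabilityMeasure P]
    (Om : S → Matrix (Fin n) (Fin (2 * r + 1)) ℝ)
    (Ps : S → Matrix (Fin (4 * r + 3)) (Fin m) ℝ)
    (hnormal : SketchyCGM.IsStandardNormalPair P Om Ps)
    -- the random reconstructions
    (Xhat : ℕ → S → Matrix (Fin m) (Fin n) ℝ)
    (hXhat_meas : ∀ t i j, AEMeasurable (fun s => Xhat t s i j) P)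
    (hXhat : ∀ t, ∀ᵐ s ∂P, SketchyCGM.IsReconstruction r (Ps s)
      (SketchyCGM.rangeSketch α u v (Om s) t) (SketchyCGM.corangeSketch α u v (Ps s) t)
      (Xhat t s)) :
    (SketchyCGM.solutionSet f A α).Nonempty ∧
    (∀ t, MeasureTheory.Integrable
      (fun s => SketchyCGM.distF (Xhat t s) (SketchyCGM.solutionSet f A α)) P) ∧
    Filter.Tendsto
      (fun t => ∫ s, SketchyCGM.distF (Xhat t s) (SketchyCGM.solutionSet f A α) ∂P)
      Filter.atTop (nhds 0) := by
  have hne := SketchyCGM.solutionSet_nonempty hf_smooth.continuous A hα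
  have hmeas := fun t => SketchyCGM.aestronglyMeasurable_distF (hXhat_meas t)
    (SketchyCGM.solutionSet f A α)
  have hnonneg : ∀ t s, 0 ≤ SketchyCGM.distF (Xhat t s) (SketchyCGM.solutionSet f A α) :=
    fun _ _ => SketchyCGM.distF_nonneg _ _
  have hfin := SketchyCGM.lintegral_distF_lt_top hα (fun t => (huv t).1) (fun t => (huv t).2.1)
    hrank hnormal hXhat hne
  refine ⟨hne, fun t => ⟨hmeas t, ?_⟩, ?_⟩
  · rw [MeasureTheory.hasFiniteIntegral_iff_ofReal (Filter.Eventually.of_forall (hnonneg t))]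
    exact hfin t
  · have hlim := SketchyCGM.tendsto_lintegral_distF hf_convex hf_smooth hα hrank huv hnormal hXhat
    have h := (ENNReal.tendsto_toReal ENNReal.zero_ne_top).comp hlim
    refine h.congr fun t => ?_
    rw [MeasureTheory.integral_eq_lintegral_of_nonneg_ae
      (Filter.Eventually.of_forall (hnonneg t)) (hmeas t), Function.comp_apply]
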